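/- For a word $c=(c_1,\dots,c_n)\in\{0,1\}^n$ let $|c|=\sum_i c_i$, let $1-c=(1-c_1,\dots,1-c_n)$, and let $\varnothing$ denote the empty word. Define real coefficients $f(c)$ by the identity of formal power series in two noncommuting variables $X,Y$ $$\sum_{k=1}^{\infty}\frac{(-1)^{k-1}}{k}\bigl(e^{X}e^{Y}-1\bigr)^{k-1}=\sum_{n=0}^\infty\sum_{c\in\{0,1\}^n}f(c)\,X^{1-c_1}Y^{c_1}\cdots X^{1-c_n}Y^{c_n},$$ and put, for $c\in\{0,1\}^n$, $$(n+2)\,g(c)=-f(c_1,\dots,c_n,1)-(-1)^n f(1-c_1,\dots,1-c_n,1),$$ $$h(c)=2g(1,c_1,\dots,c_n)-2g(0,c_1,\dots,c_n)+\sum_{m=0}^n(-1)^m g(c_m,\dots,c_1)\,g(c_{m+1},\dots,c_n),$$ $$\delta=\min\Bigl(\tfrac1{12}\Bigl(\sum_{n=1}^\infty\sum_{c\in\{0,1\}^n}|h(c)|\bigl(\tfrac{\log 2}{3}\bigr)^n\Bigr)^{-1},\,1\Bigr),\qquad \Delta=\min\Bigl(\tfrac{\log 2}{6}\,\delta,\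 \tfrac14\log 2\Bigr).$$ For complex square matrices $A,B$ of the same size let $[A,B]=AB-BA$, $\mathrm{ad}(A)(X)=[A,X]$, $\mathrm{ad}(A,B)^{c}=\mathrm{ad}(A)^{1-c_1}\circ\mathrm{ad}(B)^{c_1}\circ\cdots\circ\mathrm{ad}(A)^{1-c_n}\circ\mathrm{ad}(B)^{c_n}$ (the identity for $c=\varnothing$), and $\|A\|_F=\sqrt{\mathrm{tr}\,A^\dagger A}$, and let the Baker–Campbell–Hausdorff series be $$M(A,B)=A+B+\sum_{n=0}^\infty\sum_{c\in\{0,1\}^n}g(c)\,\mathrm{ad}(A,B)^{c}([A,B])=A+B+\tfrac12[A,B]+\tfrac1{12}\bigl([A,[A,B]]+[B,[B,A]]\bigr)+\cdots.$$ Then the series in the definition of $\delta$ converges and $\Delta>0$. Moreover, for all anti-Hermitian complex matrices $A,B$ of the same (arbitrary) size with $\|A\|_F<\Delta$ and $\|B\|_F<\Delta$, the series $M(A,B)$ converges, $e^{M(A,B)}=e^Ae^B$, and $$\|M(A,B)\|_F^2\le 2\|A\|_F^2+2\|B\|_F^2-\|A-B\|_F^2 .$$ -/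

import Mathlib

open scoped Matrix

noncomputable section

namespace BCH

/-! Words `c = (c₁, …, cₙ) ∈ {0,1}ⁿ` are lists of Booleans: `false` is the letter `0` (standing
for `A`) and `true` is the letter `1` (standing for `B`).  A formal power series with real
coefficients in two noncommuting variables `A`, `B` is the function that sends a word to its
coefficient. -/

/-- Real formal power series in two noncommuting variables, given by their coefficients. -/
abbrev NCSeries : Type := List Bool → ℝ

/-- The series `1`. -/
def ncOne : NCSeries := fun w => if w = [] then 1 else 0

/-- The product of noncommutative power series: sum over all factorizations of a word. -/
def ncMul (u v : NCSeries) : NCSeries :=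
  fun w => ∑ i ∈ Finset.range (w.length + 1), u (w.take i) * v (w.drop i)

/-- Powers of a noncommutative power series. -/
def ncPow (u : NCSeries) : ℕ → NCSeries
  | 0 => ncOne
  | k + 1 => ncMul u (ncPow u k)

/-- The series `∑ⱼ Xʲ / j!`, with `X` the variable of the letter `b`. -/
def ncExp (b : Bool) : NCSeries :=
  fun w => if w = List.replicate w.length b then 1 / (w.length.factorial : ℝ) else 0

/-- The series `e^A e^B - 1`. -/
def ncZ : NCSeries := fun w => ncMul (ncExp false) (ncExp true) w - ncOne w

/-- The coefficients of `∑_{k ≥ 0} (-1)ᵏ / (k + 1) (e^A e^B - 1)ᵏ`.  As `e^A e^B - 1` has no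
constant term, its `k`-th power has no terms of degree less than `k`, so that only
`k ≤ |w|` contributes to the coefficient of `w`. -/
def f : NCSeries :=
  fun w => ∑ k ∈ Finset.range (w.length + 1), (-1 : ℝ) ^ k / ((k : ℝ) + 1) * ncPow ncZ k w

/-- `(n + 2) g(c) = - f(c, 1) - (-1)ⁿ f(1 - c, 1)` for a word `c` of length `n`. -/
def g (c : List Bool) : ℝ :=
  (-f (c ++ [true]) - (-1 : ℝ) ^ c.length * f (c.map not ++ [true])) / ((c.length : ℝ) + 2)

/-- `h(c) = 2 g(1, c) - 2 g(0, c) + ∑_{m = 0}^{n} (-1)ᵐ g(cₘ, …, c₁) g(cₘ₊₁, …, cₙ)`. -/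
def h (c : List Bool) : ℝ :=
  2 * g (true :: c) - 2 * g (false :: c)
    + ∑ m ∈ Finset.range (c.length + 1), (-1 : ℝ) ^ m * g (c.take m).reverse * g (c.drop m)

/-- The term `∑_{c ∈ {0,1}ⁿ} |h(c)| (log 2 / 3)ⁿ`. -/
def hTerm (n : ℕ) : ℝ :=
  ∑ c : Fin n → Bool, |h (List.ofFn c)| * (Real.log 2 / 3) ^ n

/-- `δ = min ((1/12) (∑_{n ≥ 1} ∑_{c ∈ {0,1}ⁿ} |h(c)| (log 2 / 3)ⁿ)⁻¹, 1)`. -/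
def smallDelta : ℝ := min (1 / 12 * (∑' n : ℕ, hTerm (n + 1))⁻¹) 1

/-- `Δ = min ((log 2 / 6) δ, (log 2) / 4)`. -/
def bigDelta : ℝ := min (Real.log 2 / 6 * smallDelta) (1 / 4 * Real.log 2)

variable {ι : Type*} [Fintype ι]

/-- The Frobenius norm `‖A‖_F = √(tr A† A)`; the trace is a nonnegative real number. -/
def frobNorm (A : Matrix ι ι ℂ) : ℝ := Real.sqrt (Matrix.trace (Aᴴ * A)).re

/-- `ad(A,B)^c = ad(A)^{1-c₁} ∘ ad(B)^{c₁} ∘ ⋯ ∘ ad(A)^{1-cₙ} ∘ ad(B)^{cₙ}` applied to `X`. -/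
def adWord (A B : Matrix ι ι ℂ) : List Bool → Matrix ι ι ℂ → Matrix ι ι ℂ
  | [], X => X
  | false :: c, X => A * adWord A B c X - adWord A B c X * A
  | true :: c, X => B * adWord A B c X - adWord A B c X * B

/-- The degree `n + 2` term `∑_{c ∈ {0,1}ⁿ} g(c) ad(A,B)^c ([A,B])` of the
Baker-Campbell-Hausdorff series. -/
def bchTerm (A B : Matrix ι ι ℂ) (n : ℕ) : Matrix ι ι ℂ :=
  ∑ c : Fin n → Bool, g (List.ofFn c) • adWord A B (List.ofFn c) (A * B - B * A)

/-- The Baker-Campbell-Hausdorff series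
`M(A,B) = A + B + ∑_{n ≥ 0} ∑_{c ∈ {0,1}ⁿ} g(c) ad(A,B)^c ([A,B])`. -/
def bch (A B : Matrix ι ι ℂ) : Matrix ι ι ℂ := A + B + ∑' n : ℕ, bchTerm A B n

end BCH

end

/-! The inequality is an energy estimate. Put P = A + B, C = [A,B] and M = P + S. For anti-Hermitian
A, B the operators ad A, ad B are skew for the inner product Re tr X†Y, so ⟪P, ad(B)u⟫ = ⟪C,u⟫ and
⟪P, ad(A)u⟫ = -⟪C,u⟫. Moving all letters to one side turns 2⟪P,S⟫ + ‖S‖² into the sum of h(c)⟪C,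
ad^c C⟫ (`norm_sq_bch_eq`). The empty word contributes -‖C‖²/12, and δ is chosen so that all longer
words together cannot exceed ‖C‖²/12 (`norm_bch_le`). Hence ‖M‖² ≤ ‖A+B‖², and the parallelogram law
finishes.

The identity e^M = e^A e^B comes from differentiating a local logarithm L(t) of e^{tA}e^{tB}. Its
derivative is ψ(A + e^{ad L}B), where ψ is log(1+z)/z at z = e^{ad L} - 1 and e^{ad L} = e^{t ad
A}e^{t ad B} (`exists_local_log`). That ψ inverts the logarithmic derivative of exp follows from a
doubling argument (`eventually_logDiv_mul_logDerivExp`). Expanding in words gives the coefficients f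
(`ncEval_f`). Integrating t^{n+1} produces the 1/(n+2) in g, and analytic continuation from t near 0
reaches t = 1 (`exp_bch_eq`).

Convergence rests on one estimate: e^X e^Y - 1 has weighted ℓ¹-norm at most e^{2x} - 1, which is
below 1 when 2x < log 2 (`wNorm_ncZ_le`). -/

namespace BCH

/-! ### The series log(1+z)/z and its doubling formula -/

section LogDiv

open Filter Topology

variable {𝔹 : Type*} [NormedRing 𝔹] [NormedAlgebra ℂ 𝔹]

/-- The coefficients `(-1)ᵏ / (k + 1)` of `log (1 + z) / z`. -/
noncomputable def logCoeff (k : ℕ) : ℂ := (-1 : ℂ) ^ k / ((k : ℂ) + 1)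

/-- The power series `log (1 + z) / z` in a Banach algebra. -/
noncomputable def logDiv (z : 𝔹) : 𝔹 := ∑' k : ℕ, logCoeff k • z ^ k

theorem logCoeff_zero : logCoeff 0 = 1 := by simp [logCoeff]

theorem norm_logCoeff (k : ℕ) : ‖logCoeff k‖ = 1 / ((k : ℝ) + 1) := by
  have : ‖(k : ℂ) + 1‖ = (k : ℝ) + 1 := by
    rw [← Nat.cast_succ, Complex.norm_natCast, Nat.cast_succ]
  simp [logCoeff, this]

theorem norm_logCoeff_le (k : ℕ) : ‖logCoeff k‖ ≤ 1 := by
  rw [norm_logCoeff]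
  exact div_le_one_of_le₀ (by linarith [(k.cast_nonneg : (0 : ℝ) ≤ k)]) (by positivity)

theorem norm_pow_le_one_mul {R : Type*} [NormedRing R] (z : R) (k : ℕ) :
    ‖z ^ k‖ ≤ ‖(1 : R)‖ * ‖z‖ ^ k := by
  induction k with
  | zero => simp
  | succ k ih =>
    rw [pow_succ, pow_succ, ← mul_assoc]
    exact (norm_mul_le _ _).trans (mul_le_mul_of_nonneg_right ih (norm_nonneg _))

theorem summable_logDiv [CompleteSpace 𝔹] {z : 𝔹} (hz : ‖z‖ < 1) :
    Summable fun k : ℕ => logCoeff k • z ^ k := by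
  refine Summable.of_norm_bounded
    ((summable_geometric_of_lt_one (norm_nonneg z) hz).mul_left ‖(1 : 𝔹)‖) fun k => ?_
  rw [norm_smul]
  exact (mul_le_of_le_one_left (norm_nonneg _) (norm_logCoeff_le k)).trans
    (norm_pow_le_one_mul z k)

theorem norm_logDiv_sub_one_le [CompleteSpace 𝔹] {z : 𝔹} (hz : ‖z‖ < 1) :
    ‖logDiv z - 1‖ ≤ ‖z‖ / (1 - ‖z‖) := by
  have h : logDiv z - 1 = ∑' k : ℕ, logCoeff (k + 1) • z ^ (k + 1) := by
    rw [logDiv, (summable_logDiv hz).tsum_eq_zero_add]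
    simp [logCoeff_zero]
  rw [h, div_eq_mul_inv]
  refine tsum_of_norm_bounded ((hasSum_geometric_of_lt_one (norm_nonneg z) hz).mul_left ‖z‖)
    fun k => ?_
  rw [norm_smul, ← pow_succ']
  exact (mul_le_of_le_one_left (norm_nonneg _) (norm_logCoeff_le _)).trans
    (norm_pow_le' z k.succ_pos)

theorem tendsto_logDiv_zero [CompleteSpace 𝔹] :
    Tendsto (logDiv : 𝔹 → 𝔹) (𝓝 0) (𝓝 1) := by
  rw [tendsto_iff_norm_sub_tendsto_zero]
  have h1 : Tendsto (fun z : 𝔹 => ‖z‖ / (1 - ‖z‖)) (𝓝 0) (𝓝 0) := by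
    have h2 : ContinuousAt (fun z : 𝔹 => ‖z‖ / (1 - ‖z‖)) 0 :=
      continuousAt_id.norm.div (continuousAt_const.sub continuousAt_id.norm) (by simp)
    simpa [ContinuousAt] using h2
  refine squeeze_zero' (Eventually.of_forall fun z => norm_nonneg _) ?_ h1
  filter_upwards [Metric.ball_mem_nhds (0 : 𝔹) one_pos] with z hz
  exact norm_logDiv_sub_one_le (by simpa using hz)

theorem isUnit_logDiv [CompleteSpace 𝔹] {z : 𝔹} (hz : ‖z‖ < 1 / 2) : IsUnit (logDiv z) := by
  have h : ‖1 - logDiv z‖ < 1 := by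
    rw [norm_sub_rev]
    refine (norm_logDiv_sub_one_le (by linarith)).trans_lt ?_
    rw [div_lt_one (by linarith)]
    linarith
  have := (Units.oneSub _ h).isUnit
  simpa using this

theorem hasDerivAt_pow_of_commute {q : ℂ → 𝔹} {q' : 𝔹} {s : ℂ} (hq : HasDerivAt q q' s)
    (hc : Commute (q s) q') (n : ℕ) :
    HasDerivAt (fun s => q s ^ (n + 1)) (((n : ℂ) + 1) • (q s ^ n * q')) s := by
  induction n with
  | zero => simpa using hq
  | succ n ih =>
    have h := ih.mul hq
    refine (h.congr_deriv ?_).congr_of_eventuallyEq (Eventually.of_forall fun s => ?_)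
    · rw [smul_mul_assoc, mul_assoc, ← hc.eq, ← mul_assoc, ← pow_succ, Nat.cast_succ,
        add_smul ((n : ℂ) + 1) 1, one_smul]
    · simp [pow_succ]

/-- Differentiation of `∑ₖ (-1)ᵏ zᵏ q(s)ᵏ⁺¹ / (k + 1)`, that is, of `log (1 + z q(s)) / z`. -/
theorem hasDerivAt_logSeries [CompleteSpace 𝔹] {z : 𝔹} {q q' p : ℂ → 𝔹} {t : Set ℂ} {ρ C : ℝ}
    (ht : IsOpen t) (ht' : IsPreconnected t) (h0 : (0 : ℂ) ∈ t) (hq0 : q 0 = 0)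
    (hq : ∀ s ∈ t, HasDerivAt q (q' s) s) (hzq : ∀ s ∈ t, Commute z (q s))
    (hqq : ∀ s ∈ t, Commute (q s) (q' s))
    (hρ : ρ < 1) (hb : ∀ s ∈ t, ‖z * q s‖ ≤ ρ) (hC : ∀ s ∈ t, ‖q' s‖ ≤ C)
    (hp : ∀ s ∈ t, q' s = (1 + z * q s) * p s) {s : ℂ} (hs : s ∈ t) :
    HasDerivAt (fun s => ∑' k : ℕ, logCoeff k • (z ^ k * q s ^ (k + 1))) (p s) s := by
  have hρ0 : 0 ≤ ρ := (norm_nonneg _).trans (hb 0 h0)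
  have hC0 : 0 ≤ C := (norm_nonneg _).trans (hC 0 h0)
  have hder : ∀ (k : ℕ), ∀ s ∈ t, HasDerivAt (fun s => logCoeff k • (z ^ k * q s ^ (k + 1)))
      ((-(z * q s)) ^ k * q' s) s := by
    intro k s hs
    have h1 := ((hasDerivAt_pow_of_commute (hq s hs) (hqq s hs) k).const_mul (z ^ k)).const_smul
      (logCoeff k)
    refine h1.congr_deriv ?_
    have h2 : logCoeff k * ((k : ℂ) + 1) = (-1) ^ k := by
      have : (k : ℂ) + 1 ≠ 0 := Nat.cast_add_one_ne_zero k
      rw [logCoeff, div_mul_cancel₀ _ this]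
    rw [mul_smul_comm, smul_smul, h2, neg_pow (z * q s), (hzq s hs).mul_pow, ← mul_assoc]
    rcases Nat.even_or_odd k with hk | hk <;> simp [hk.neg_one_pow]
  have hbd : ∀ (k : ℕ), ∀ s ∈ t, ‖(-(z * q s)) ^ k * q' s‖ ≤ (‖(1 : 𝔹)‖ * C) * ρ ^ k := by
    intro k s hs
    calc ‖(-(z * q s)) ^ k * q' s‖ ≤ (‖(1 : 𝔹)‖ * ‖-(z * q s)‖ ^ k) * C :=
          (norm_mul_le _ _).trans (mul_le_mul (norm_pow_le_one_mul _ _) (hC s hs)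
            (norm_nonneg _) (by positivity))
      _ ≤ (‖(1 : 𝔹)‖ * ρ ^ k) * C := by
          rw [norm_neg]
          gcongr
          exact hb s hs
      _ = _ := by ring
  have hmain := hasDerivAt_tsum_of_isPreconnected
    ((summable_geometric_of_lt_one hρ0 hρ).mul_left (‖(1 : 𝔹)‖ * C)) ht ht' hder hbd h0
    (by simp [hq0]) hs
  -- The differentiated series is `q' s` times the geometric series inverting `1 + z * q s`, a
  -- factor that `q' s` contains by `hp`.
  refine hmain.congr_deriv ?_
  have hlt : ‖-(z * q s)‖ < 1 := by
    rw [norm_neg]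
    exact (hb s hs).trans_lt hρ
  have hsum : Summable fun k : ℕ => (-(z * q s)) ^ k := by
    refine Summable.of_norm_bounded
      ((summable_geometric_of_lt_one (norm_nonneg _) hlt).mul_left ‖(1 : 𝔹)‖) fun k => ?_
    exact norm_pow_le_one_mul _ _
  rw [hsum.tsum_mul_right, hp s hs, ← mul_assoc]
  have := geom_series_mul_neg (-(z * q s)) hlt
  rw [sub_neg_eq_add] at this
  rw [this, one_mul]

/-- The identity `log ((1 + z) ^ 2) = 2 log (1 + z)`, divided by `z`. -/
theorem logDiv_sq [CompleteSpace 𝔹] {z : 𝔹} (hz : ‖z‖ < 1 / 3) :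
    logDiv (2 * z + z ^ 2) * (2 + z) = 2 * logDiv z := by
  -- The radius exceeds 1, so that s = 1 is allowed, yet keeps ‖sz‖ ≤ 2/5 and hence ‖2sz + (sz)²‖ ≤
  -- 24/25 < 1.
  set t : Set ℂ := Metric.ball 0 (6 / 5) with ht
  have hto : IsOpen t := Metric.isOpen_ball
  have htc : IsPreconnected t := (convex_ball _ _).isPreconnected
  have h0 : (0 : ℂ) ∈ t := by simp [ht]
  have h1 : (1 : ℂ) ∈ t := by rw [ht, mem_ball_zero_iff]; norm_num
  have hn : ∀ s ∈ t, ‖s • z‖ ≤ 2 / 5 := by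
    intro s hs
    rw [norm_smul]
    rw [ht, mem_ball_zero_iff] at hs
    nlinarith [norm_nonneg z, norm_nonneg s]
  set p : ℂ → 𝔹 := fun s => ∑' k : ℕ, (-(s • z)) ^ k with hpdef
  have hp : ∀ s ∈ t, (1 + s • z) * p s = 1 := by
    intro s hs
    have := mul_neg_geom_series (-(s • z)) (by rw [norm_neg]; linarith [hn s hs])
    rwa [sub_neg_eq_add] at this
  have hd1 : ∀ s ∈ t, HasDerivAt
      (fun s : ℂ => ∑' k : ℕ, logCoeff k • (z ^ k * (s • (1 : 𝔹)) ^ (k + 1))) (p s) s := by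
    intro s hs
    refine hasDerivAt_logSeries (q := fun s => s • (1 : 𝔹)) (q' := fun _ => 1) (ρ := 2 / 5)
      (C := ‖(1 : 𝔹)‖) hto htc h0 (by simp) ?_ ?_ ?_ (by norm_num) ?_ ?_ ?_ hs
    · intro s _
      simpa using (hasDerivAt_id s).smul_const (1 : 𝔹)
    · intro s _
      exact (Commute.one_right z).smul_right s
    · intro s _
      exact Commute.one_right _
    · intro s hs
      simpa using hn s hs
    · intro s _
      exact le_rfl
    · intro s hs
      simpa using (hp s hs).symm
  -- Chosen so that 1 + z·q2(s) = (1 + sz)². Working with q2 performs the division by z formally,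
  -- since z need not be invertible.
  set q2 : ℂ → 𝔹 := fun s => (2 * s) • (1 : 𝔹) + (s ^ 2) • z with hq2
  have hzq2 : ∀ s, 1 + z * q2 s = (1 + s • z) * (1 + s • z) := by
    intro s
    simp only [hq2, mul_add, add_mul, mul_smul_comm, smul_mul_assoc, smul_add, one_mul, mul_one,
      two_mul, add_smul, pow_two, mul_smul]
    abel
  have hd2 : ∀ s ∈ t, HasDerivAt
      (fun s : ℂ => ∑' k : ℕ, logCoeff k • (z ^ k * q2 s ^ (k + 1))) (2 * p s) s := by
    intro s hs
    refine hasDerivAt_logSeries (q := q2) (q' := fun s => (2 : ℂ) • (1 : 𝔹) + (2 * s) • z)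
      (p := fun s => 2 * p s)
      (ρ := 24 / 25) (C := ‖(2 : ℂ) • (1 : 𝔹)‖ + 4 / 5) hto htc h0 (by simp [hq2]) ?_ ?_ ?_
      (by norm_num) ?_ ?_ ?_ hs
    · intro s _
      have ha : HasDerivAt (fun s : ℂ => (2 * s) • (1 : 𝔹)) ((2 : ℂ) • (1 : 𝔹)) s := by
        simpa using ((hasDerivAt_id s).const_mul (2 : ℂ)).smul_const (1 : 𝔹)
      have hb : HasDerivAt (fun s : ℂ => (s ^ 2) • z) ((2 * s) • z) s := by
        simpa using ((hasDerivAt_id s).pow 2).smul_const z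
      exact ha.add hb
    · intro s _
      exact ((Commute.one_right z).smul_right _).add_right ((Commute.refl z).smul_right _)
    · intro s _
      refine Commute.add_left ?_ ?_
      · exact (Commute.one_left _).smul_left _
      · exact (((Commute.one_right z).smul_right _).add_right
          ((Commute.refl z).smul_right _)).smul_left _
    · intro s hs
      have he : z * q2 s = (s • z) + (s • z) + (s • z) * (s • z) := by
        have := hzq2 s
        simp only [mul_add, add_mul, mul_one, one_mul] at this
        have h3 : z * q2 s = 1 + z * q2 s - 1 := by abel
        rw [h3, this]
        abel
      rw [he]
      have h4 := norm_mul_le (s • z) (s • z)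
      have h5 := hn s hs
      calc _ ≤ ‖s • z‖ + ‖s • z‖ + ‖(s • z) * (s • z)‖ := norm_add₃_le
        _ ≤ _ := by nlinarith [norm_nonneg (s • z)]
    · intro s hs
      refine (norm_add_le _ _).trans (add_le_add_right ?_ _)
      rw [mul_smul, norm_smul]
      have := hn s hs
      norm_num
      linarith
    · intro s hs
      have h6 : (2 : ℂ) • (1 : 𝔹) + (2 * s) • z = 2 * (1 + s • z) := by
        rw [mul_smul, ← smul_add, two_smul, two_mul]
      rw [hzq2]
      have h7 : (1 + s • z) * (1 + s • z) * (2 * p s)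
          = 2 * ((1 + s • z) * ((1 + s • z) * p s)) := by
        noncomm_ring
      rw [h6, h7, hp s hs, mul_one]
  have heq : Set.EqOn (fun s : ℂ => ∑' k : ℕ, logCoeff k • (z ^ k * q2 s ^ (k + 1)))
      (fun s => 2 * ∑' k : ℕ, logCoeff k • (z ^ k * (s • (1 : 𝔹)) ^ (k + 1))) t := by
    refine hto.eqOn_of_deriv_eq (𝕜 := ℂ) htc
      (fun s hs => (hd2 s hs).differentiableAt.differentiableWithinAt)
      (fun s hs => ((hd1 s hs).const_mul 2).differentiableAt.differentiableWithinAt)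
      (fun s hs => ?_) h0 ?_
    · rw [(hd2 s hs).deriv, ((hd1 s hs).const_mul 2).deriv]
    · simp [hq2]
  have h8 := heq h1
  have hq1 : q2 1 = 2 + z := by
    simp only [hq2]
    rw [mul_one, one_pow, one_smul, two_smul, one_add_one_eq_two]
  have hc : Commute z (2 + z) := by
    refine Commute.add_right ?_ (Commute.refl z)
    exact Nat.cast_ofNat (R := 𝔹) (n := 2) ▸ Nat.commute_cast z 2
  have hzz : 2 * z + z ^ 2 = z * (2 + z) := by rw [hc.eq, add_mul, pow_two]
  have hlt : ‖2 * z + z ^ 2‖ < 1 := by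
    rw [two_mul, pow_two]
    have h4 := norm_mul_le z z
    calc _ ≤ ‖z‖ + ‖z‖ + ‖z * z‖ := norm_add₃_le
      _ < _ := by nlinarith [norm_nonneg z]
  have h9 : logDiv (2 * z + z ^ 2) * (2 + z)
      = ∑' k : ℕ, logCoeff k • (z ^ k * (2 + z) ^ (k + 1)) := by
    rw [logDiv, ← (summable_logDiv hlt).tsum_mul_right]
    refine tsum_congr fun k => ?_
    rw [hzz, hc.mul_pow, smul_mul_assoc, pow_succ (2 + z), mul_assoc]
  rw [h9]
  simpa [hq1, logDiv] using h8

end LogDiv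

end BCH

namespace BCH

/-! ### The derivative of the exponential map -/

section DExp

open Filter Topology NormedSpace

variable {𝔸 : Type*} [NormedRing 𝔸] [NormedAlgebra ℂ 𝔸] [CompleteSpace 𝔸]

theorem mul_self_sub_one_eq {R : Type*} [Ring R] (a : R) :
    a * a - 1 = 2 * (a - 1) + (a - 1) ^ 2 := by
  rw [pow_two]
  noncomm_ring

theorem hasSum_congr_fun {E β : Type*} [AddCommMonoid E] [TopologicalSpace E] {u v : β → E} {a : E}
    (h : HasSum u a) (huv : ∀ b, u b = v b) : HasSum v a :=
  funext huv ▸ h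

theorem continuous_exp : Continuous (exp : 𝔸 → 𝔸) :=
  letI := NormedAlgebra.restrictScalars ℚ ℂ 𝔸
  NormedSpace.exp_continuous

theorem exp_add_of_comm {x y : 𝔸} (h : Commute x y) : exp (x + y) = exp x * exp y :=
  letI := NormedAlgebra.restrictScalars ℚ ℂ 𝔸
  NormedSpace.exp_add_of_commute h

theorem exp_mul_exp_neg (x : 𝔸) : exp x * exp (-x) = 1 := by
  rw [← exp_add_of_comm (Commute.neg_right (Commute.refl x)), add_neg_cancel, exp_zero]

theorem exp_neg_mul_exp (x : 𝔸) : exp (-x) * exp x = 1 := by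
  rw [← exp_add_of_comm (Commute.neg_left (Commute.refl x)), neg_add_cancel, exp_zero]

theorem hasSum_exp (x : 𝔸) : HasSum (fun n : ℕ => ((n.factorial : ℂ)⁻¹) • x ^ n) (exp x) :=
  NormedSpace.exp_series_hasSum_exp' x

variable (𝔸) in
/-- Left multiplication as a continuous linear map. -/
noncomputable def mulL : 𝔸 →L[ℂ] 𝔸 →L[ℂ] 𝔸 := ContinuousLinearMap.mul ℂ 𝔸

variable (𝔸) in
/-- Right multiplication as a continuous linear map. -/
noncomputable def mulR : 𝔸 →L[ℂ] 𝔸 →L[ℂ] 𝔸 := (ContinuousLinearMap.mul ℂ 𝔸).flip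

variable (𝔸) in
/-- The adjoint representation `X ↦ (Y ↦ X Y - Y X)`. -/
noncomputable def adL : 𝔸 →L[ℂ] 𝔸 →L[ℂ] 𝔸 := mulL 𝔸 - mulR 𝔸

omit [CompleteSpace 𝔸] in
@[simp] theorem mulL_apply (x y : 𝔸) : mulL 𝔸 x y = x * y := rfl

omit [CompleteSpace 𝔸] in
@[simp] theorem mulR_apply (x y : 𝔸) : mulR 𝔸 x y = y * x := rfl

omit [CompleteSpace 𝔸] in
@[simp] theorem adL_apply (x y : 𝔸) : adL 𝔸 x y = x * y - y * x := rfl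

theorem exp_mulL (x : 𝔸) : exp (mulL 𝔸 x) = mulL 𝔸 (exp x) := by
  refine (hasSum_exp (mulL 𝔸 x)).unique ?_
  have hpow : ∀ n : ℕ, mulL 𝔸 (x ^ n) = mulL 𝔸 x ^ n := by
    intro n
    induction n with
    | zero => ext y; simp
    | succ n ih => rw [pow_succ, pow_succ, ← ih]; ext y; simp [mul_assoc]
  refine hasSum_congr_fun ((mulL 𝔸).hasSum (hasSum_exp x)) fun n => ?_
  rw [← hpow]
  exact map_smul (mulL 𝔸) _ _

theorem exp_mulR (x : 𝔸) : exp (mulR 𝔸 x) = mulR 𝔸 (exp x) := by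
  refine (hasSum_exp (mulR 𝔸 x)).unique ?_
  have hpow : ∀ n : ℕ, mulR 𝔸 (x ^ n) = mulR 𝔸 x ^ n := by
    intro n
    induction n with
    | zero => ext y; simp
    | succ n ih => rw [pow_succ', pow_succ, ← ih]; ext y; simp [mul_assoc]
  refine hasSum_congr_fun ((mulR 𝔸).hasSum (hasSum_exp x)) fun n => ?_
  rw [← hpow]
  exact map_smul (mulR 𝔸) _ _

/-- Left and right multiplications commute, so the exponential of their difference factors. -/
theorem exp_adL (x : 𝔸) : exp (adL 𝔸 x) = mulL 𝔸 (exp x) * mulR 𝔸 (exp (-x)) := by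
  have hc : Commute (mulL 𝔸 x) (mulR 𝔸 (-x)) := by
    ext y
    simp [mul_assoc]
  have h : adL 𝔸 x = mulL 𝔸 x + mulR 𝔸 (-x) := by
    rw [map_neg, ← sub_eq_add_neg]
    rfl
  rw [h, exp_add_of_comm hc, exp_mulL, exp_mulR]

theorem exp_adL_apply (x y : 𝔸) : exp (adL 𝔸 x) y = exp x * y * exp (-x) := by
  rw [exp_adL]
  simp [mul_assoc]

theorem differentiable_exp : Differentiable ℂ (exp : 𝔸 → 𝔸) :=
  fun x => (NormedSpace.exp_analytic x).differentiableAt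

theorem contDiff_exp : ContDiff ℂ 1 (exp : 𝔸 → 𝔸) :=
  contDiff_iff_contDiffAt.2 fun x => (NormedSpace.exp_analytic x).contDiffAt

/-- The right logarithmic derivative `H ↦ (D exp)_X(H) e^{-X}` of the exponential function. -/
noncomputable def logDerivExp (x : 𝔸) : 𝔸 →L[ℂ] 𝔸 := mulR 𝔸 (exp (-x)) * fderiv ℂ exp x

omit [CompleteSpace 𝔸] in
theorem logDerivExp_apply (x y : 𝔸) : logDerivExp x y = fderiv ℂ exp x y * exp (-x) := rfl

theorem logDerivExp_zero : logDerivExp (0 : 𝔸) = 1 := by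
  ext y
  rw [logDerivExp_apply, hasFDerivAt_exp_zero.fderiv]
  simp

theorem continuous_logDerivExp : Continuous (logDerivExp : 𝔸 → 𝔸 →L[ℂ] 𝔸) :=
  ((mulR 𝔸).continuous.comp (continuous_exp.comp continuous_neg)).mul
    (contDiff_exp.continuous_fderiv one_ne_zero)

/-- Differentiate e^{2x} = e^x e^x and multiply by e^{-2x} on the right: one term of the product
rule is the logarithmic derivative at x, the other is its conjugate by e^x. -/
theorem logDerivExp_two_smul (x : 𝔸) :
    (2 : ℂ) • logDerivExp ((2 : ℂ) • x) = (1 + exp (adL 𝔸 x)) * logDerivExp x := by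
  have h1 : HasFDerivAt (fun x : 𝔸 => exp ((2 : ℂ) • x))
      ((fderiv ℂ exp ((2 : ℂ) • x)).comp ((2 : ℂ) • ContinuousLinearMap.id ℂ 𝔸)) x :=
    (differentiable_exp ((2 : ℂ) • x)).hasFDerivAt.comp x
      ((hasFDerivAt_id x).const_smul (2 : ℂ))
  have h2 := (differentiable_exp x).hasFDerivAt.mul' (differentiable_exp x).hasFDerivAt
  have h3 : (fun x : 𝔸 => exp ((2 : ℂ) • x)) = exp * exp := by
    funext y
    rw [Pi.mul_apply, two_smul, exp_add_of_comm (Commute.refl y)]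
  rw [h3] at h1
  have h4 := h1.unique h2
  ext y
  have h5 := congrArg (fun φ : 𝔸 →L[ℂ] 𝔸 => φ y) h4
  simp only [ContinuousLinearMap.comp_apply, smul_apply,
    ContinuousLinearMap.id_apply, add_apply, map_smul, smul_eq_mul,
    MulOpposite.smul_eq_mul_unop, MulOpposite.unop_op] at h5
  rw [smul_apply, logDerivExp_apply, ← smul_mul_assoc, h5,
    mul_apply_eq_comp, add_apply, exp_adL_apply,
    one_apply_eq_self, logDerivExp_apply]
  have h6 : exp (-((2 : ℂ) • x)) = exp (-x) * exp (-x) := by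
    rw [two_smul, neg_add, exp_add_of_comm (Commute.refl _)]
  rw [h6, add_mul, add_comm]
  congr 1
  · rw [mul_assoc, ← mul_assoc (exp x), exp_mul_exp_neg, one_mul]
  · simp only [mul_assoc]

/-- This is the derivative of the constant e^x e^{-x} = 1. -/
theorem logDerivExp_neg (x : 𝔸) : exp (adL 𝔸 x) * logDerivExp (-x) = logDerivExp x := by
  have h1 : HasFDerivAt (fun x : 𝔸 => exp (-x))
      ((fderiv ℂ exp (-x)).comp (-ContinuousLinearMap.id ℂ 𝔸)) x :=
    (differentiable_exp (-x)).hasFDerivAt.comp x (hasFDerivAt_id x).neg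
  have h2 := (differentiable_exp x).hasFDerivAt.mul' h1
  have h3 : (exp * fun x : 𝔸 => exp (-x)) = fun _ => 1 := by
    funext y
    rw [Pi.mul_apply, exp_mul_exp_neg]
  rw [h3] at h2
  have h4 := h2.unique (hasFDerivAt_const 1 x)
  ext y
  have h5 := congrArg (fun φ : 𝔸 →L[ℂ] 𝔸 => φ y) h4
  simp only [ContinuousLinearMap.comp_apply, smul_apply,
    neg_apply, ContinuousLinearMap.id_apply, add_apply,
    map_neg, smul_eq_mul, MulOpposite.smul_eq_mul_unop, MulOpposite.unop_op, mul_neg,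
    zero_apply] at h5
  rw [mul_apply_eq_comp, exp_adL_apply, logDerivExp_apply, logDerivExp_apply, neg_neg,
    ← eq_neg_add_iff_add_eq.2 h5 |>.symm]
  simp [mul_assoc, exp_mul_exp_neg]

/-- Neither factor is expanded in powers of ad x. By `logDiv_sq` and `logDerivExp_two_smul` the
factors 1 + e^{ad x} match, so the product takes the same value at x and 2x. Halving x repeatedly
and continuity at 0 force that value to be 1. -/
theorem eventually_logDiv_mul_logDerivExp :
    ∀ᶠ x : 𝔸 in 𝓝 0, logDiv (exp (adL 𝔸 x) - 1) * logDerivExp x = 1 := by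
  have hcont : Continuous fun x : 𝔸 => exp (adL 𝔸 x) - 1 :=
    (continuous_exp.comp (adL 𝔸).continuous).sub continuous_const
  have hz : Tendsto (fun x : 𝔸 => exp (adL 𝔸 x) - 1) (𝓝 0) (𝓝 0) := by
    simpa using hcont.tendsto 0
  have hP : Tendsto (fun x : 𝔸 => logDiv (exp (adL 𝔸 x) - 1) * logDerivExp x) (𝓝 0) (𝓝 1) := by
    have := (tendsto_logDiv_zero.comp hz).mul (continuous_logDerivExp.tendsto (0 : 𝔸))
    simpa [logDerivExp_zero] using this
  obtain ⟨r, hr, hball⟩ := Metric.eventually_nhds_iff_ball.1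
    (hz.eventually (Metric.ball_mem_nhds (0 : 𝔸 →L[ℂ] 𝔸) (by norm_num : (0 : ℝ) < 1 / 3)))
  have hstep : ∀ x ∈ Metric.ball (0 : 𝔸) r,
      logDiv (exp (adL 𝔸 ((2 : ℂ) • x)) - 1) * logDerivExp ((2 : ℂ) • x)
        = logDiv (exp (adL 𝔸 x) - 1) * logDerivExp x := by
    intro x hx
    have h1 : ‖exp (adL 𝔸 x) - 1‖ < 1 / 3 := by simpa using hball x hx
    have h2 := logDiv_sq h1
    have h3 : exp (adL 𝔸 ((2 : ℂ) • x)) - 1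
        = 2 * (exp (adL 𝔸 x) - 1) + (exp (adL 𝔸 x) - 1) ^ 2 := by
      rw [two_smul, map_add, exp_add_of_comm (Commute.refl _)]
      exact mul_self_sub_one_eq _
    have h4 : 2 + (exp (adL 𝔸 x) - 1) = 1 + exp (adL 𝔸 x) := by
      rw [← one_add_one_eq_two]
      abel
    rw [← h3, h4] at h2
    have h5 : (2 : ℂ) • (logDiv (exp (adL 𝔸 ((2 : ℂ) • x)) - 1) * logDerivExp ((2 : ℂ) • x))
        = (2 : ℂ) • (logDiv (exp (adL 𝔸 x) - 1) * logDerivExp x) := by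
      refine (Algebra.mul_smul_comm (2 : ℂ) _ _).symm.trans ?_
      rw [logDerivExp_two_smul, ← mul_assoc, h2, mul_assoc, two_mul]
      exact (two_smul ℂ _).symm
    exact smul_right_injective _ (two_ne_zero' ℂ) h5
  filter_upwards [Metric.ball_mem_nhds (0 : 𝔸) hr] with x hx
  have hmem : ∀ n : ℕ, ((2 : ℂ)⁻¹ ^ n) • x ∈ Metric.ball (0 : 𝔸) r := by
    intro n
    rw [mem_ball_zero_iff] at hx ⊢
    rw [norm_smul, norm_pow, norm_inv, Complex.norm_ofNat]
    exact (mul_le_of_le_one_left (norm_nonneg _)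
      (pow_le_one₀ (by norm_num) (by norm_num))).trans_lt hx
  have hconst : ∀ n : ℕ, logDiv (exp (adL 𝔸 (((2 : ℂ)⁻¹ ^ n) • x)) - 1)
      * logDerivExp (((2 : ℂ)⁻¹ ^ n) • x) = logDiv (exp (adL 𝔸 x) - 1) * logDerivExp x := by
    intro n
    induction n with
    | zero => simp
    | succ n ih =>
      rw [← ih, ← hstep _ (hmem (n + 1)), smul_smul, pow_succ', ← mul_assoc,
        mul_inv_cancel₀ two_ne_zero, one_mul]
  have hlim : Tendsto (fun n : ℕ => ((2 : ℂ)⁻¹ ^ n) • x) atTop (𝓝 0) := by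
    have : Tendsto (fun n : ℕ => (2 : ℂ)⁻¹ ^ n) atTop (𝓝 0) :=
      tendsto_pow_atTop_nhds_zero_of_norm_lt_one (by norm_num)
    simpa using this.smul_const x
  have := hP.comp hlim
  simp only [Function.comp_def, hconst] at this
  exact tendsto_nhds_unique tendsto_const_nhds this

/-- Formally, with w = ad x, this is (-w)/(e^{-w}-1) = w e^w/(e^w-1). It is obtained by comparing
the inverses of the logarithmic derivative at x and -x. -/
theorem eventually_logDiv_exp_neg :
    ∀ᶠ x : 𝔸 in 𝓝 0, logDiv (exp (adL 𝔸 (-x)) - 1)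
      = logDiv (exp (adL 𝔸 x) - 1) * exp (adL 𝔸 x) := by
  have hcont : Continuous fun x : 𝔸 => exp (adL 𝔸 x) - 1 :=
    (continuous_exp.comp (adL 𝔸).continuous).sub continuous_const
  have hz : Tendsto (fun x : 𝔸 => exp (adL 𝔸 x) - 1) (𝓝 0) (𝓝 0) := by
    simpa using hcont.tendsto 0
  have hneg : Tendsto (fun x : 𝔸 => -x) (𝓝 0) (𝓝 0) := by
    simpa using (continuous_neg (G := 𝔸)).tendsto 0
  filter_upwards [eventually_logDiv_mul_logDerivExp (𝔸 := 𝔸),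
    hneg.eventually (eventually_logDiv_mul_logDerivExp (𝔸 := 𝔸)),
    hz.eventually (Metric.ball_mem_nhds (0 : 𝔸 →L[ℂ] 𝔸) (by norm_num : (0 : ℝ) < 1 / 2))]
    with x h1 h2 h3
  -- Invertibility upgrades the one-sided identity `h1` to an equality of `logDerivExp x` with a
  -- two-sided inverse.
  obtain ⟨u, hu⟩ := isUnit_logDiv (z := exp (adL 𝔸 x) - 1) (by simpa using h3)
  rw [← hu] at h1 ⊢
  have hW : logDerivExp x = ↑u⁻¹ := by
    rw [← Units.inv_mul_cancel_left u (logDerivExp x), h1, mul_one]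
  have h4 : logDiv (exp (adL 𝔸 (-x)) - 1) * exp (adL 𝔸 (-x)) * logDerivExp x = 1 := by
    rw [← logDerivExp_neg x, mul_assoc, ← mul_assoc (exp (adL 𝔸 (-x))), map_neg,
      exp_neg_mul_exp, one_mul, ← map_neg, h2]
  rw [hW] at h4
  have h5 : logDiv (exp (adL 𝔸 (-x)) - 1) * exp (adL 𝔸 (-x)) = u :=
    Units.mul_inv_eq_one.1 h4
  rw [← h5, mul_assoc, map_neg, exp_neg_mul_exp, mul_one]

end DExp

end BCH

namespace BCH

/-! ### A local logarithm of e^{tA}e^{tB} -/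

section LocalLog

open Filter Topology NormedSpace

variable {𝔸 : Type*} [NormedRing 𝔸] [NormedAlgebra ℂ 𝔸] [CompleteSpace 𝔸]

theorem exp_neg_eq_of_exp_eq_mul {x a b : 𝔸} (h : exp x = exp a * exp b) :
    exp (-x) = exp (-b) * exp (-a) := by
  have h1 : exp (-x) * (exp a * exp b) = 1 := by rw [← h, exp_neg_mul_exp]
  calc exp (-x) = exp (-x) * (exp a * (exp b * exp (-b)) * exp (-a)) := by
        rw [exp_mul_exp_neg, mul_one, exp_mul_exp_neg, mul_one]
    _ = exp (-x) * (exp a * exp b) * (exp (-b) * exp (-a)) := by simp only [mul_assoc]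
    _ = _ := by rw [h1, one_mul]

theorem exp_adL_of_exp_eq_mul {x a b : 𝔸} (h : exp x = exp a * exp b) :
    exp (adL 𝔸 x) = exp (adL 𝔸 a) * exp (adL 𝔸 b) := by
  ext y
  rw [mul_apply_eq_comp, exp_adL_apply, exp_adL_apply, exp_adL_apply,
    exp_neg_eq_of_exp_eq_mul h, h]
  simp only [mul_assoc]

/-- Near the identity there is a differentiable logarithm. -/
theorem exists_local_inverse_exp : ∃ ℓ : 𝔸 → 𝔸, ℓ 1 = 0 ∧
    ∀ᶠ y in 𝓝 (1 : 𝔸), exp (ℓ y) = y ∧ DifferentiableAt ℂ ℓ y := by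
  have hc : ContDiffAt ℂ 1 (exp : 𝔸 → 𝔸) 0 := contDiff_exp.contDiffAt
  have hf : HasFDerivAt (exp : 𝔸 → 𝔸)
      ((ContinuousLinearEquiv.refl ℂ 𝔸 : 𝔸 ≃L[ℂ] 𝔸) : 𝔸 →L[ℂ] 𝔸) 0 := hasFDerivAt_exp_zero
  refine ⟨hc.localInverse hf one_ne_zero, ?_, ?_⟩
  · have := hc.localInverse_apply_image hf one_ne_zero
    rwa [exp_zero] at this
  · have h1 := (hc.hasStrictFDerivAt' hf one_ne_zero).eventually_right_inverse
    have h2 := (hc.to_localInverse hf one_ne_zero).eventually (by simp)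
    rw [exp_zero] at h1 h2
    filter_upwards [h1, h2] with y hy1 hy2
    exact ⟨hy1, hy2.differentiableAt one_ne_zero⟩

/-- Differentiating e^L = e^{tA}e^{tB} gives A + e^{ad L}B as logarithmic derivative, to which the
inverse is applied. `eventually_logDiv_exp_neg` absorbs the e^{ad L} in front of B, giving the same
kind of series in the letters -tB, -tA. The result involves L only through e^{ad L}, which is
explicit. -/
theorem exists_local_log (A B : 𝔸) : ∃ L : ℂ → 𝔸, L 0 = 0 ∧ ∀ᶠ t in 𝓝 (0 : ℂ),
    exp (L t) = exp (t • A) * exp (t • B) ∧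
      HasDerivAt L (logDiv (exp (adL 𝔸 (t • A)) * exp (adL 𝔸 (t • B)) - 1) A
        + logDiv (exp (adL 𝔸 (-(t • B))) * exp (adL 𝔸 (-(t • A))) - 1) B) t := by
  obtain ⟨ℓ, hℓ1, hℓ⟩ := exists_local_inverse_exp (𝔸 := 𝔸)
  set y : ℂ → 𝔸 := fun t => exp (t • A) * exp (t • B) with hy
  have hy0 : y 0 = 1 := by simp [hy, exp_zero]
  have hyd : ∀ t, HasDerivAt y (A * y t + y t * B) t := by
    intro t
    have h := (hasDerivAt_exp_smul_const' A t).mul (hasDerivAt_exp_smul_const B t)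
    simp only [hy, mul_assoc] at h ⊢
    exact h
  have hyc : Tendsto y (𝓝 0) (𝓝 1) := hy0 ▸ (hyd 0).continuousAt.tendsto
  have hLd0 : DifferentiableAt ℂ (fun t => ℓ (y t)) 0 := by
    have h := hℓ.self_of_nhds.2
    rw [← hy0] at h
    exact DifferentiableAt.comp (0 : ℂ) h (hyd 0).differentiableAt
  have hL0 : Tendsto (fun t => ℓ (y t)) (𝓝 0) (𝓝 0) := by
    have := hLd0.continuousAt.tendsto
    rwa [hy0, hℓ1] at this
  refine ⟨fun t => ℓ (y t), by simp only [hy0, hℓ1], ?_⟩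
  -- The identity e^L = y is needed on a whole neighbourhood of t, because it is differentiated
  -- there.
  filter_upwards [(hyc.eventually hℓ).eventually_nhds,
    hL0.eventually eventually_logDiv_mul_logDerivExp,
    hL0.eventually eventually_logDiv_exp_neg] with t ht h1 h2
  obtain ⟨hexp, hdiff⟩ := ht.self_of_nhds
  refine ⟨hexp, ?_⟩
  have hLd : HasDerivAt (fun t => ℓ (y t)) (deriv (fun t => ℓ (y t)) t) t :=
    (DifferentiableAt.comp t hdiff (hyd t).differentiableAt).hasDerivAt
  refine hLd.congr_deriv ?_
  set x := ℓ (y t) with hx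
  set x' := deriv (fun t => ℓ (y t)) t with hx'
  have hexp_neg := exp_neg_eq_of_exp_eq_mul hexp
  have had := exp_adL_of_exp_eq_mul hexp
  have had' : exp (adL 𝔸 (-x)) = exp (adL 𝔸 (-(t • B))) * exp (adL 𝔸 (-(t • A))) :=
    exp_adL_of_exp_eq_mul hexp_neg
  rw [← had, ← had', h2]
  have hchain : HasDerivAt (fun t => exp (ℓ (y t))) (fderiv ℂ exp x x') t :=
    (differentiable_exp x).hasFDerivAt.comp_hasDerivAt t hLd
  have hev : (fun t => exp (ℓ (y t))) =ᶠ[𝓝 t] y := ht.mono fun s hs => hs.1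
  have hder : fderiv ℂ exp x x' = A * y t + y t * B :=
    (hchain.congr_of_eventuallyEq hev.symm).unique (hyd t)
  have hW : logDerivExp x x' = A + exp (adL 𝔸 x) B := by
    rw [logDerivExp_apply, hder, exp_adL_apply, hexp, add_mul, mul_assoc A, ← hexp,
      exp_mul_exp_neg, mul_one]
  calc x' = (logDiv (exp (adL 𝔸 x) - 1) * logDerivExp x) x' := by rw [h1]; rfl
    _ = logDiv (exp (adL 𝔸 x) - 1) (A + exp (adL 𝔸 x) B) := by rw [mul_apply_eq_comp, hW]
    _ = _ := by rw [map_add, mul_apply_eq_comp]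

end LocalLog

end BCH

namespace BCH

/-! ### Weighted ℓ¹-norms and evaluation of noncommutative series -/

section Words

open NormedSpace

/-- A word with a cut corresponds to a pair of words. -/
def cutEquiv (α : Type*) : List α × List α ≃ Σ w : List α, Fin (w.length + 1) where
  toFun p := ⟨p.1 ++ p.2, ⟨p.1.length, by simp⟩⟩
  invFun q := (q.1.take q.2, q.1.drop q.2)
  left_inv p := by simp
  right_inv := by
    rintro ⟨w, i, hi⟩
    have h1 : w.take i ++ w.drop i = w := List.take_append_drop i w
    have h2 : (w.take i).length = i := by simp; omega
    refine Sigma.ext h1 ?_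
    rw [Fin.heq_ext_iff (by simp)]
    exact h2

theorem summable_sum_cut {α E : Type*} [NormedAddCommGroup E] [CompleteSpace E]
    {φ : List α → List α → E} (h : Summable fun p : List α × List α => φ p.1 p.2) :
    Summable fun w : List α => ∑ i ∈ Finset.range (w.length + 1), φ (w.take i) (w.drop i) := by
  have h1 := ((cutEquiv α).symm.summable_iff.2 h).sigma
  refine h1.congr fun w => ?_
  rw [tsum_fintype, ← Fin.sum_univ_eq_sum_range fun i => φ (w.take i) (w.drop i)]
  rfl

theorem tsum_sum_cut {α E : Type*} [NormedAddCommGroup E] [CompleteSpace E]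
    {φ : List α → List α → E} (h : Summable fun p : List α × List α => φ p.1 p.2) :
    ∑' w : List α, ∑ i ∈ Finset.range (w.length + 1), φ (w.take i) (w.drop i)
      = ∑' p : List α × List α, φ p.1 p.2 := by
  have h1 := ((cutEquiv α).symm.summable_iff.2 h).tsum_sigma
  rw [(cutEquiv α).symm.tsum_eq (fun p : List α × List α => φ p.1 p.2) |>.symm]
  refine Eq.trans (tsum_congr fun w => ?_) h1.symm
  rw [tsum_fintype, ← Fin.sum_univ_eq_sum_range fun i => φ (w.take i) (w.drop i)]
  rfl

/-- Absolute summability of a noncommutative series at radius `x`. -/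
def WSummable (x : ℝ) (u : NCSeries) : Prop := Summable fun c : List Bool => |u c| * x ^ c.length

/-- The weighted `ℓ¹`-norm of a noncommutative series. -/
noncomputable def wNorm (x : ℝ) (u : NCSeries) : ℝ := ∑' c : List Bool, |u c| * x ^ c.length

theorem wNorm_nonneg {x : ℝ} (hx : 0 ≤ x) (u : NCSeries) : 0 ≤ wNorm x u :=
  tsum_nonneg fun _ => by positivity

theorem summable_prod_weight {x : ℝ} (hx : 0 ≤ x) {u v : NCSeries} (hu : WSummable x u)
    (hv : WSummable x v) : Summable fun p : List Bool × List Bool =>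
      (|u p.1| * x ^ p.1.length) * (|v p.2| * x ^ p.2.length) :=
  Summable.mul_of_nonneg hu hv (fun _ => by positivity) fun _ => by positivity

theorem ncMul_weight_le {x : ℝ} (hx : 0 ≤ x) (u v : NCSeries) (w : List Bool) :
    |ncMul u v w| * x ^ w.length ≤ ∑ i ∈ Finset.range (w.length + 1),
      (|u (w.take i)| * x ^ (w.take i).length) * (|v (w.drop i)| * x ^ (w.drop i).length) := by
  rw [ncMul]
  refine (mul_le_mul_of_nonneg_right (Finset.abs_sum_le_sum_abs _ _) (by positivity)).trans ?_
  rw [Finset.sum_mul]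
  refine Finset.sum_le_sum fun i _ => le_of_eq ?_
  have : x ^ w.length = x ^ (w.take i).length * x ^ (w.drop i).length := by
    rw [← pow_add, ← List.length_append, List.take_append_drop]
  rw [this, abs_mul]
  ring

theorem WSummable.mul {x : ℝ} (hx : 0 ≤ x) {u v : NCSeries} (hu : WSummable x u)
    (hv : WSummable x v) : WSummable x (ncMul u v) :=
  Summable.of_nonneg_of_le (fun _ => by positivity) (ncMul_weight_le hx u v)
    (summable_sum_cut (φ := fun c d => (|u c| * x ^ c.length) * (|v d| * x ^ d.length))
      (summable_prod_weight hx hu hv))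

theorem wNorm_ncMul_le {x : ℝ} (hx : 0 ≤ x) {u v : NCSeries} (hu : WSummable x u)
    (hv : WSummable x v) : wNorm x (ncMul u v) ≤ wNorm x u * wNorm x v := by
  rw [wNorm, wNorm, wNorm, hu.tsum_mul_tsum hv (summable_prod_weight hx hu hv),
    ← tsum_sum_cut (φ := fun c d => (|u c| * x ^ c.length) * (|v d| * x ^ d.length))
      (summable_prod_weight hx hu hv)]
  exact Summable.tsum_le_tsum (ncMul_weight_le hx u v) (hu.mul hx hv)
    (summable_sum_cut (φ := fun c d => (|u c| * x ^ c.length) * (|v d| * x ^ d.length))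
      (summable_prod_weight hx hu hv))

theorem hasSum_ncOne (x : ℝ) : HasSum (fun c : List Bool => |ncOne c| * x ^ c.length) 1 := by
  convert hasSum_ite_eq ([] : List Bool) (1 : ℝ) using 2 with c
  by_cases hc : c = [] <;> simp [ncOne, hc]

theorem hasSum_ncExp (x : ℝ) (b : Bool) :
    HasSum (fun c : List Bool => |ncExp b c| * x ^ c.length) (Real.exp x) := by
  have hinj : Function.Injective fun n : ℕ => List.replicate n b := fun m n h => by
    simpa using congrArg List.length h
  refine (hinj.hasSum_iff ?_).1 ?_
  · intro c hc
    have : c ≠ List.replicate c.length b := fun h => hc ⟨c.length, h.symm⟩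
    simp [ncExp, this]
  · have h := NormedSpace.expSeries_div_hasSum_exp (𝔸 := ℝ) x
    rw [← Real.exp_eq_exp_ℝ] at h
    refine hasSum_congr_fun h fun n => ?_
    simp only [Function.comp_apply, ncExp, List.length_replicate, if_true]
    rw [abs_of_nonneg (by positivity)]
    ring

theorem ncZ_nil : ncZ [] = 0 := by simp [ncZ, ncMul, ncExp, ncOne]

theorem ncExp_nonneg (b : Bool) (c : List Bool) : 0 ≤ ncExp b c := by
  rw [ncExp]
  split_ifs <;> positivity

/-- The coefficients of e^X e^Y are nonnegative with constant term exactly 1, so subtracting 1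
creates no cancellation to account for. -/
theorem abs_ncZ (c : List Bool) :
    |ncZ c| = |ncMul (ncExp false) (ncExp true) c| - |ncOne c| := by
  have h0 : 0 ≤ ncMul (ncExp false) (ncExp true) c :=
    Finset.sum_nonneg fun i _ => mul_nonneg (ncExp_nonneg _ _) (ncExp_nonneg _ _)
  by_cases hc : c = []
  · subst hc
    rw [ncZ_nil]
    simp [ncMul, ncExp, ncOne]
  · simp [ncZ, ncOne, hc]

theorem wSummable_ncZ {x : ℝ} (hx : 0 ≤ x) : WSummable x ncZ := by
  have h := (WSummable.mul hx (hasSum_ncExp x false).summable (hasSum_ncExp x true).summable).sub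
    (hasSum_ncOne x).summable
  refine h.congr fun c => ?_
  rw [abs_ncZ, sub_mul]

theorem wNorm_ncZ_le {x : ℝ} (hx : 0 ≤ x) : wNorm x ncZ ≤ Real.exp (2 * x) - 1 := by
  have h1 : wNorm x ncZ = wNorm x (ncMul (ncExp false) (ncExp true)) - 1 := by
    rw [wNorm, wNorm, ← (hasSum_ncOne x).tsum_eq, ← Summable.tsum_sub
      (WSummable.mul hx (hasSum_ncExp x false).summable (hasSum_ncExp x true).summable)
      (hasSum_ncOne x).summable]
    refine tsum_congr fun c => ?_
    rw [abs_ncZ, sub_mul]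
  have h2 := wNorm_ncMul_le hx (hasSum_ncExp x false).summable (hasSum_ncExp x true).summable
  rw [wNorm, wNorm, wNorm, (hasSum_ncExp x false).tsum_eq, (hasSum_ncExp x true).tsum_eq,
    ← Real.exp_add, ← two_mul] at h2
  rw [h1]
  exact sub_le_sub_right h2 1

theorem WSummable.pow {x : ℝ} (hx : 0 ≤ x) {u : NCSeries} (hu : WSummable x u) (k : ℕ) :
    WSummable x (ncPow u k) := by
  induction k with
  | zero => exact (hasSum_ncOne x).summable
  | succ k ih => exact hu.mul hx ih

theorem wNorm_ncPow_le {x : ℝ} (hx : 0 ≤ x) {u : NCSeries} (hu : WSummable x u) (k : ℕ) :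
    wNorm x (ncPow u k) ≤ wNorm x u ^ k := by
  induction k with
  | zero => exact (hasSum_ncOne x).tsum_eq.le
  | succ k ih =>
    rw [pow_succ']
    exact (wNorm_ncMul_le hx hu (hu.pow hx k)).trans
      (mul_le_mul_of_nonneg_left ih (wNorm_nonneg hx u))

theorem ncPow_ncZ_eq_zero (k : ℕ) (w : List Bool) (h : w.length < k) : ncPow ncZ k w = 0 := by
  induction k generalizing w with
  | zero => simp at h
  | succ k ih =>
    rw [ncPow, ncMul]
    refine Finset.sum_eq_zero fun i hi => ?_
    rcases Nat.eq_zero_or_pos i with rfl | hi0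
    · simp [ncZ_nil]
    · rw [ih _ (by rw [List.length_drop, Finset.mem_range] at *; omega), mul_zero]

/-- The k-th power has norm at most the k-th power of a number below 1. Absolute convergence over
words and powers jointly justifies the interchange in `ncEval_f`. -/
theorem summable_ncPow_weight {x : ℝ} (hx : 0 ≤ x) (hx2 : Real.exp (2 * x) < 2) :
    Summable fun p : List Bool × ℕ => |ncPow ncZ p.2 p.1| * x ^ p.1.length := by
  have hz := wSummable_ncZ hx
  have hlt : wNorm x ncZ < 1 := (wNorm_ncZ_le hx).trans_lt (by linarith)
  rw [← (Equiv.prodComm ℕ (List Bool)).summable_iff]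
  refine (summable_prod_of_nonneg fun _ => by simp only [Function.comp_apply]; positivity).2
    ⟨fun k => hz.pow hx k, ?_⟩
  exact Summable.of_nonneg_of_le (fun k => wNorm_nonneg hx _) (wNorm_ncPow_le hx hz)
    (summable_geometric_of_lt_one (wNorm_nonneg hx _) hlt)

variable {𝔹 : Type*} [NormedRing 𝔹] [NormedAlgebra ℂ 𝔹]

/-- The value of a word in a Banach algebra. -/
def wordEval (a : Bool → 𝔹) (c : List Bool) : 𝔹 := (c.map a).prod

/-- The value of a noncommutative series in a Banach algebra. -/
noncomputable def ncEval (a : Bool → 𝔹) (u : NCSeries) : 𝔹 :=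
  ∑' c : List Bool, (u c : ℂ) • wordEval a c

omit [NormedAlgebra ℂ 𝔹] in
theorem norm_wordEval_le {a : Bool → 𝔹} {x : ℝ} (h1 : ‖(1 : 𝔹)‖ ≤ 1) (ha : ∀ b, ‖a b‖ ≤ x)
    (c : List Bool) : ‖wordEval a c‖ ≤ x ^ c.length := by
  have hx : 0 ≤ x := (norm_nonneg _).trans (ha true)
  induction c with
  | nil => simpa [wordEval] using h1
  | cons b c ih =>
    have : wordEval a (b :: c) = a b * wordEval a c := by simp [wordEval]
    rw [this, List.length_cons, pow_succ']
    exact (norm_mul_le _ _).trans (mul_le_mul (ha b) ih (norm_nonneg _) hx)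

theorem norm_smul_wordEval_le {a : Bool → 𝔹} {x : ℝ} (h1 : ‖(1 : 𝔹)‖ ≤ 1) (ha : ∀ b, ‖a b‖ ≤ x)
    (r : ℝ) (c : List Bool) : ‖(r : ℂ) • wordEval a c‖ ≤ |r| * x ^ c.length := by
  rw [norm_smul, Complex.norm_real, Real.norm_eq_abs]
  exact mul_le_mul_of_nonneg_left (norm_wordEval_le h1 ha c) (abs_nonneg _)

variable [CompleteSpace 𝔹] {a : Bool → 𝔹} {x : ℝ}

theorem WSummable.eval (h1 : ‖(1 : 𝔹)‖ ≤ 1) (ha : ∀ b, ‖a b‖ ≤ x) {u : NCSeries}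
    (hu : WSummable x u) : Summable fun c : List Bool => (u c : ℂ) • wordEval a c :=
  Summable.of_norm_bounded hu fun c => norm_smul_wordEval_le h1 ha (u c) c

theorem ncEval_ncMul (h1 : ‖(1 : 𝔹)‖ ≤ 1) (ha : ∀ b, ‖a b‖ ≤ x) {u v : NCSeries}
    (hu : WSummable x u) (hv : WSummable x v) :
    ncEval a (ncMul u v) = ncEval a u * ncEval a v := by
  have hx : 0 ≤ x := (norm_nonneg _).trans (ha true)
  have hs : Summable fun p : List Bool × List Bool =>
      ((u p.1 : ℂ) • wordEval a p.1) * ((v p.2 : ℂ) • wordEval a p.2) := by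
    refine Summable.of_norm_bounded (summable_prod_weight hx hu hv) fun p => ?_
    exact (norm_mul_le _ _).trans (mul_le_mul (norm_smul_wordEval_le h1 ha _ _)
      (norm_smul_wordEval_le h1 ha _ _) (norm_nonneg _) (by positivity))
  rw [ncEval, ncEval, ncEval, (hu.eval h1 ha).tsum_mul_tsum (hv.eval h1 ha) hs, ← tsum_sum_cut
    (φ := fun c d => ((u c : ℂ) • wordEval a c) * ((v d : ℂ) • wordEval a d)) hs]
  refine tsum_congr fun w => ?_
  rw [ncMul, Complex.ofReal_sum, Finset.sum_smul]
  refine Finset.sum_congr rfl fun i _ => ?_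
  have : wordEval a w = wordEval a (w.take i) * wordEval a (w.drop i) := by
    rw [wordEval, wordEval, wordEval, ← List.prod_append, ← List.map_append,
      List.take_append_drop]
  rw [this, smul_mul_smul_comm, Complex.ofReal_mul]

omit [CompleteSpace 𝔹] in
theorem ncEval_ncOne : ncEval a ncOne = 1 := by
  rw [ncEval, tsum_eq_single []]
  · simp [ncOne, wordEval]
  · intro c hc
    simp [ncOne, hc]

theorem ncEval_ncExp (b : Bool) : ncEval a (ncExp b) = exp (a b) := by
  have hinj : Function.Injective fun n : ℕ => List.replicate n b := fun m n h => by
    simpa using congrArg List.length h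
  rw [ncEval, ← hinj.tsum_eq, ← (hasSum_exp (a b)).tsum_eq]
  · refine tsum_congr fun n => ?_
    simp [ncExp, wordEval]
  · intro c hc
    by_contra h
    have : c ≠ List.replicate c.length b := fun h' => h ⟨c.length, h'.symm⟩
    simp [ncExp, this] at hc

theorem ncEval_ncZ (h1 : ‖(1 : 𝔹)‖ ≤ 1) (ha : ∀ b, ‖a b‖ ≤ x) :
    ncEval a ncZ = exp (a false) * exp (a true) - 1 := by
  have hx : 0 ≤ x := (norm_nonneg _).trans (ha true)
  have hX : WSummable x (ncExp false) := (hasSum_ncExp x false).summable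
  have hY : WSummable x (ncExp true) := (hasSum_ncExp x true).summable
  have hO : WSummable x ncOne := (hasSum_ncOne x).summable
  rw [← ncEval_ncExp (a := a), ← ncEval_ncExp (a := a), ← ncEval_ncMul h1 ha hX hY,
    ← ncEval_ncOne (a := a), ncEval, ncEval, ncEval,
    ← ((hX.mul hx hY).eval h1 ha).tsum_sub (hO.eval h1 ha)]
  refine tsum_congr fun c => ?_
  rw [ncZ, Complex.ofReal_sub, sub_smul]

theorem ncEval_ncPow (h1 : ‖(1 : 𝔹)‖ ≤ 1) (ha : ∀ b, ‖a b‖ ≤ x) {u : NCSeries}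
    (hu : WSummable x u) (k : ℕ) : ncEval a (ncPow u k) = ncEval a u ^ k := by
  have hx : 0 ≤ x := (norm_nonneg _).trans (ha true)
  induction k with
  | zero => rw [pow_zero, ncPow, ncEval_ncOne]
  | succ k ih => rw [ncPow, ncEval_ncMul h1 ha hu (hu.pow hx k), ih, pow_succ']

theorem f_eq_sum_logCoeff (c : List Bool) : (f c : ℂ)
    = ∑ k ∈ Finset.range (c.length + 1), logCoeff k * (ncPow ncZ k c : ℂ) := by
  rw [f]
  push_cast [logCoeff]
  rfl

theorem abs_f_le (c : List Bool) :
    |f c| ≤ ∑ k ∈ Finset.range (c.length + 1), |ncPow ncZ k c| := by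
  rw [← Real.norm_eq_abs, ← Complex.norm_real, f_eq_sum_logCoeff]
  refine norm_sum_le_of_le _ fun k _ => ?_
  rw [norm_mul, Complex.norm_real, Real.norm_eq_abs]
  exact mul_le_of_le_one_left (abs_nonneg _) (norm_logCoeff_le k)

theorem wSummable_f {x : ℝ} (hx : 0 ≤ x) (hx2 : Real.exp (2 * x) < 2) : WSummable x f := by
  have hs := summable_ncPow_weight hx hx2
  refine Summable.of_nonneg_of_le (fun c => by positivity) (fun c => ?_) hs.prod
  refine (mul_le_mul_of_nonneg_right (abs_f_le c) (by positivity)).trans ?_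
  rw [Finset.sum_mul]
  exact (hs.prod_factor c).sum_le_tsum _ fun k _ => by positivity

/-- The double series over words and powers is summed in the other order. The cutoff k ≤ |c| in `f`
loses nothing, by `ncPow_ncZ_eq_zero`. -/
theorem ncEval_f (h1 : ‖(1 : 𝔹)‖ ≤ 1) (ha : ∀ b, ‖a b‖ ≤ x) (hx2 : Real.exp (2 * x) < 2) :
    ncEval a f = logDiv (exp (a false) * exp (a true) - 1) := by
  have hx : 0 ≤ x := (norm_nonneg _).trans (ha true)
  have hs : Summable fun p : List Bool × ℕ =>
      logCoeff p.2 • ((ncPow ncZ p.2 p.1 : ℂ) • wordEval a p.1) := by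
    refine Summable.of_norm_bounded (summable_ncPow_weight hx hx2) fun p => ?_
    rw [norm_smul]
    exact (mul_le_of_le_one_left (norm_nonneg _) (norm_logCoeff_le _)).trans
      (norm_smul_wordEval_le h1 ha _ _)
  have h2 : ∀ c : List Bool, (f c : ℂ) • wordEval a c
      = ∑' k : ℕ, logCoeff k • ((ncPow ncZ k c : ℂ) • wordEval a c) := by
    intro c
    rw [tsum_eq_sum (s := Finset.range (c.length + 1)), f_eq_sum_logCoeff, Finset.sum_smul]
    · simp only [mul_smul]
    · intro k hk
      rw [ncPow_ncZ_eq_zero k c (by simpa using hk)]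
      simp
  rw [ncEval, tsum_congr h2, ← hs.tsum_prod, ← ncEval_ncZ h1 ha, logDiv,
    ← (Equiv.prodComm ℕ (List Bool)).tsum_eq]
  have hs' := (Equiv.prodComm ℕ (List Bool)).summable_iff.2 hs
  refine hs'.tsum_prod.trans (tsum_congr fun k => ?_)
  rw [← ncEval_ncPow h1 ha (wSummable_ncZ hx), ncEval,
    ← (((wSummable_ncZ hx).pow hx k).eval h1 ha).tsum_const_smul]
  rfl

end Words

end BCH

namespace BCH

/-! ### Summability and low-degree values of g and h -/

section Coefficients

theorem abs_g_le (c : List Bool) :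
    |g c| ≤ |f (c ++ [true])| + |f (c.map not ++ [true])| := by
  have h1 : (1 : ℝ) ≤ (c.length : ℝ) + 2 := by linarith [(c.length.cast_nonneg : (0 : ℝ) ≤ _)]
  rw [g, abs_div, abs_of_pos (by linarith : (0 : ℝ) < (c.length : ℝ) + 2)]
  refine (div_le_self (abs_nonneg _) h1).trans ((abs_sub _ _).trans_eq ?_)
  rw [abs_neg, abs_mul, abs_pow, abs_neg, abs_one, one_pow, one_mul]

theorem summable_f_append {x : ℝ} (hx : 0 < x) (hx2 : Real.exp (2 * x) < 2) :
    Summable fun c : List Bool => |f (c ++ [true])| * x ^ c.length := by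
  have h := ((wSummable_f hx.le hx2).comp_injective
    (List.append_left_injective [true])).mul_left x⁻¹
  refine h.congr fun c => ?_
  simp only [Function.comp_apply, List.length_append, List.length_singleton, pow_succ]
  field_simp

/-- Exchanging the two letters in a word. -/
def swapEquiv : List Bool ≃ List Bool :=
  ⟨List.map not, List.map not, fun c => by simp [Function.comp_def],
    fun c => by simp [Function.comp_def]⟩

/-- Reversal of words. -/
def reverseEquiv : List Bool ≃ List Bool :=
  ⟨List.reverse, List.reverse, List.reverse_reverse, List.reverse_reverse⟩

theorem summable_f_swap {x : ℝ} (hx : 0 < x) (hx2 : Real.exp (2 * x) < 2) :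
    Summable fun c : List Bool => |f (c.map not ++ [true])| * x ^ c.length := by
  refine (swapEquiv.summable_iff.2 (summable_f_append hx hx2)).congr fun c => ?_
  simp [swapEquiv]

theorem wSummable_g {x : ℝ} (hx : 0 < x) (hx2 : Real.exp (2 * x) < 2) : WSummable x g := by
  refine Summable.of_nonneg_of_le (fun c => by positivity) (fun c => ?_)
    ((summable_f_append hx hx2).add (summable_f_swap hx hx2))
  rw [← add_mul]
  exact mul_le_mul_of_nonneg_right (abs_g_le c) (by positivity)

theorem WSummable.comp_cons {x : ℝ} (hx : 0 < x) {u : NCSeries} (hu : WSummable x u) (b : Bool) :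
    Summable fun c : List Bool => |u (b :: c)| * x ^ c.length := by
  have h := (hu.comp_injective (List.cons_injective (a := b))).mul_left x⁻¹
  refine h.congr fun c => ?_
  simp only [Function.comp_apply, List.length_cons, pow_succ]
  field_simp

theorem WSummable.comp_reverse {x : ℝ} {u : NCSeries} (hu : WSummable x u) :
    WSummable x fun c => u c.reverse := by
  refine (reverseEquiv.summable_iff.2 hu).congr fun c => ?_
  simp [reverseEquiv]

theorem abs_h_le (c : List Bool) : |h c| ≤ 2 * |g (true :: c)| + 2 * |g (false :: c)|
    + |∑ m ∈ Finset.range (c.length + 1), (-1 : ℝ) ^ m * g (c.take m).reverse * g (c.drop m)| := by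
  rw [h]
  refine (abs_add_le _ _).trans (add_le_add_left ((abs_sub _ _).trans_eq ?_) _)
  simp [abs_mul]

theorem wSummable_h {x : ℝ} (hx : 0 < x) (hx2 : Real.exp (2 * x) < 2) : WSummable x h := by
  have hg := wSummable_g hx hx2
  -- The quadratic part of `h` is dominated by this product series, and reversal does not change the
  -- weighted norm.
  have h3 : WSummable x fun c => |ncMul (fun c => |g c.reverse|) (fun c => |g c|) c| := by
    have := WSummable.mul hx.le (u := fun c => |g c.reverse|) (v := fun c => |g c|)
      (by simpa [WSummable] using hg.comp_reverse) (by simpa [WSummable] using hg)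
    simpa [WSummable] using this
  have hs := (((hg.comp_cons hx true).mul_left 2).add ((hg.comp_cons hx false).mul_left 2)).add h3
  refine Summable.of_nonneg_of_le (fun c => by positivity) (fun c => ?_) hs
  rw [← mul_assoc, ← mul_assoc, ← add_mul, ← add_mul]
  refine mul_le_mul_of_nonneg_right ((abs_h_le c).trans (add_le_add_right ?_ _)) (by positivity)
  rw [abs_abs]
  refine (Finset.abs_sum_le_sum_abs _ _).trans ((le_abs_self _).trans_eq' ?_)
  refine Finset.sum_congr rfl fun i _ => ?_
  rw [abs_mul, abs_mul, abs_pow, abs_neg, abs_one, one_pow, one_mul]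

theorem summable_ofFn {E : Type*} [NormedAddCommGroup E] [CompleteSpace E] {φ : List Bool → E}
    (hφ : Summable φ) : Summable fun n : ℕ => ∑ c : Fin n → Bool, φ (List.ofFn c) := by
  have h1 := (List.equivSigmaTuple.symm.summable_iff.2 hφ).sigma
  refine h1.congr fun n => ?_
  rw [tsum_fintype]
  rfl

theorem tsum_ofFn {E : Type*} [NormedAddCommGroup E] [CompleteSpace E] {φ : List Bool → E}
    (hφ : Summable φ) : ∑' n : ℕ, ∑ c : Fin n → Bool, φ (List.ofFn c) = ∑' c, φ c := by
  have h1 := (List.equivSigmaTuple.symm.summable_iff.2 hφ).tsum_sigma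
  rw [← List.equivSigmaTuple.symm.tsum_eq φ]
  refine Eq.trans (tsum_congr fun n => ?_) h1.symm
  rw [tsum_fintype]
  rfl

theorem log_two_div_three_pos : 0 < Real.log 2 / 3 := by
  have := Real.log_pos one_lt_two
  positivity

theorem exp_two_mul_log_two_div_three_lt : Real.exp (2 * (Real.log 2 / 3)) < 2 := by
  have := Real.log_pos one_lt_two
  calc _ < Real.exp (Real.log 2) := Real.exp_lt_exp.2 (by linarith)
    _ = 2 := Real.exp_log two_pos

theorem summable_hTerm : Summable hTerm := by
  refine (summable_ofFn (wSummable_h log_two_div_three_pos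
    exp_two_mul_log_two_div_three_lt)).congr fun n => ?_
  simp [hTerm]

theorem hTerm_nonneg (n : ℕ) : 0 ≤ hTerm n := by
  have := log_two_div_three_pos
  exact Finset.sum_nonneg fun c _ => by positivity

theorem ncOne_nil : ncOne [] = 1 := by simp [ncOne]

theorem ncOne_cons (b : Bool) (c : List Bool) : ncOne (b :: c) = 0 := by simp [ncOne]

theorem f_singleton (a : Bool) : f [a] = -(1 / 2) * ncZ [a] := by
  simp [f, ncPow, ncMul, Finset.sum_range_succ, ncZ_nil, ncOne_nil, ncOne_cons]
  ring

theorem f_pair (a b : Bool) : f [a, b] = -(1 / 2) * ncZ [a, b] + 1 / 3 * (ncZ [a] * ncZ [b]) := by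
  simp [f, ncPow, ncMul, Finset.sum_range_succ, ncZ_nil, ncOne_nil, ncOne_cons]
  ring

theorem f_triple (a b c : Bool) : f [a, b, c] = -(1 / 2) * ncZ [a, b, c]
    + 1 / 3 * (ncZ [a] * ncZ [b, c] + ncZ [a, b] * ncZ [c])
    - 1 / 4 * (ncZ [a] * ncZ [b] * ncZ [c]) := by
  simp [f, ncPow, ncMul, Finset.sum_range_succ, ncZ_nil, ncOne_nil, ncOne_cons]
  ring

theorem ncZ_singleton (a : Bool) : ncZ [a] = 1 := by
  cases a <;> simp [ncZ, ncOne_cons, ncMul, ncExp, Finset.sum_range_succ]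

theorem ncZ_pair (a b : Bool) :
    ncZ [a, b] = if a = b then 1 / 2 else if a = true then 0 else 1 := by
  cases a <;> cases b <;>
    simp [ncZ, ncOne_cons, ncMul, ncExp, Finset.sum_range_succ, List.replicate]

theorem ncZ_triple (a b c : Bool) : ncZ [a, b, c] =
    if a = true then (if b = true ∧ c = true then 1 / 6 else 0)
    else if b = true then (if c = true then 1 / 2 else 0)
    else if c = true then 1 / 2 else 1 / 6 := by
  cases a <;> cases b <;> cases c <;>
    simp [ncZ, ncOne_cons, ncMul, ncExp, Finset.sum_range_succ, List.replicate, Nat.factorial]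

theorem g_nil : g [] = 1 / 2 := by
  simp [g, f_singleton, ncZ_singleton]

theorem g_true : g [true] = -(1 / 12) := by
  norm_num [g, f_pair, ncZ_singleton, ncZ_pair]

theorem g_false : g [false] = 1 / 12 := by
  norm_num [g, f_pair, ncZ_singleton, ncZ_pair]

/-- This negative coefficient of ‖C‖² is what pays for all longer words, and it is the source of the
1/12 in `smallDelta`. -/
theorem h_nil : h [] = -(1 / 12) := by
  simp only [h, g_nil, g_true, g_false, List.length_nil, zero_add, Finset.sum_range_one,
    List.take_nil, List.drop_nil, List.reverse_nil]
  norm_num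

theorem g_true_false : g [true, false] = -(1 / 48) := by
  norm_num [g, f_triple, ncZ_singleton, ncZ_pair, ncZ_triple]

theorem g_false_false : g [false, false] = 0 := by
  norm_num [g, f_triple, ncZ_singleton, ncZ_pair, ncZ_triple]

theorem h_false : h [false] = -(1 / 24) := by
  simp [h, g_true_false, g_false_false, Finset.sum_range_succ, g_nil, g_false]
  norm_num

/-- One nonzero coefficient of length 1 suffices. Were the sum zero, the convention 0⁻¹ = 0 would
make δ vanish. -/
theorem tsum_hTerm_pos : 0 < ∑' n : ℕ, hTerm (n + 1) := by
  refine ((summable_nat_add_iff 1).2 summable_hTerm).tsum_pos (fun n => hTerm_nonneg _) 0 ?_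
  have hx := log_two_div_three_pos
  refine Finset.sum_pos' (fun c _ => by positivity) ⟨fun _ => false, Finset.mem_univ _, ?_⟩
  have : List.ofFn (fun _ : Fin (0 + 1) => false) = [false] := by simp
  rw [this, h_false]
  norm_num
  positivity

theorem smallDelta_pos : 0 < smallDelta :=
  lt_min (mul_pos (by norm_num) (inv_pos.2 tsum_hTerm_pos)) one_pos

theorem bigDelta_pos : 0 < bigDelta := by
  have h1 := Real.log_pos one_lt_two
  exact lt_min (mul_pos (by positivity) smallDelta_pos) (by positivity)

end Coefficients

end BCH

namespace BCH

/-! ### The Baker–Campbell–Hausdorff identity -/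

section Series

open Filter Topology NormedSpace

theorem tsum_eq_nil_add_append_true {E : Type*} [NormedAddCommGroup E] [CompleteSpace E]
    {φ : List Bool → E} (hφ : Summable φ) (h0 : ∀ c, φ (c ++ [false]) = 0) :
    ∑' c, φ c = φ [] + ∑' c, φ (c ++ [true]) := by
  have hinj : Function.Injective fun c : List Bool => c ++ [true] := List.append_left_injective _
  have h1 : ∀ c, c ∉ Set.range (fun c : List Bool => c ++ [true]) → c ≠ [] → φ c = 0 := by
    intro c hc hne
    rcases List.eq_nil_or_concat c with rfl | ⟨d, b, rfl⟩
    · exact absurd rfl hne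
    · cases b
      · simpa using h0 d
      · exact absurd ⟨d, by simp⟩ hc
  have h2 := hφ.tsum_eq_add_tsum_ite []
  rw [h2, ← hinj.tsum_eq]
  · congr 1
    exact tsum_congr fun c => by simp
  · intro c hc
    by_contra hn
    by_cases hne : c = []
    · simp [hne] at hc
    · simp [hne, h1 c hn hne] at hc

variable {𝔸 : Type*} [NormedRing 𝔸] [NormedAlgebra ℂ 𝔸]

/-- The two generators `ad A`, `ad B`. -/
noncomputable def adGen (A B : 𝔸) (b : Bool) : 𝔸 →L[ℂ] 𝔸 := if b then adL 𝔸 B else adL 𝔸 A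

theorem wordEval_append_apply (a : Bool → 𝔸 →L[ℂ] 𝔸) (c : List Bool) (b : Bool) (v : 𝔸) :
    wordEval a (c ++ [b]) v = wordEval a c (a b v) := by
  simp [wordEval]

theorem wordEval_cons_apply (a : Bool → 𝔸 →L[ℂ] 𝔸) (c : List Bool) (b : Bool) (v : 𝔸) :
    wordEval a (b :: c) v = a b (wordEval a c v) := by
  simp [wordEval]

theorem wordEval_smul_apply (a : Bool → 𝔸 →L[ℂ] 𝔸) (t : ℂ) (c : List Bool) (v : 𝔸) :
    wordEval (fun b => t • a b) c v = t ^ c.length • wordEval a c v := by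
  induction c with
  | nil => simp [wordEval]
  | cons b c ih =>
    rw [wordEval_cons_apply, wordEval_cons_apply, ih, smul_apply, map_smul, smul_smul,
      List.length_cons, pow_succ']

theorem wordEval_comp_not (a : Bool → 𝔸 →L[ℂ] 𝔸) (c : List Bool) :
    wordEval (fun b => a (!b)) c = wordEval a (c.map not) := by
  simp [wordEval, Function.comp_def]

theorem norm_one_clm_le : ‖(1 : 𝔸 →L[ℂ] 𝔸)‖ ≤ 1 := ContinuousLinearMap.norm_id_le

theorem norm_smul_wordEval_apply_le {a : Bool → 𝔸 →L[ℂ] 𝔸} {x : ℝ} (ha : ∀ b, ‖a b‖ ≤ x)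
    (r : ℝ) (c : List Bool) (v : 𝔸) :
    ‖(r : ℂ) • wordEval a c v‖ ≤ |r| * x ^ c.length * ‖v‖ := by
  rw [norm_smul, Complex.norm_real, Real.norm_eq_abs, mul_assoc]
  refine mul_le_mul_of_nonneg_left ?_ (abs_nonneg _)
  exact ((wordEval a c).le_opNorm v).trans
    (mul_le_mul_of_nonneg_right (norm_wordEval_le norm_one_clm_le ha c) (norm_nonneg _))

theorem norm_neg_smul_le {E : Type*} [NormedAddCommGroup E] [NormedSpace ℂ E]
    {t : ℂ} {v : E} {x : ℝ}
    (h : ‖t • v‖ ≤ x) : ‖(-t) • v‖ ≤ x := by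
  rwa [neg_smul, norm_neg]

theorem hasSum_clm_apply {β : Type*} {φ : β → 𝔸 →L[ℂ] 𝔸} {S : 𝔸 →L[ℂ] 𝔸} (hφ : HasSum φ S) (v : 𝔸) :
    HasSum (fun b => φ b v) (S v) :=
  (ContinuousLinearMap.apply ℂ 𝔸 v).hasSum hφ

variable [CompleteSpace 𝔸]

theorem f_nil : f [] = 1 := by simp [f, ncPow, ncOne]

/-- The last letter of a word acts first and `a false` kills v, so only the empty word and words
ending in `true` survive. This is why g involves f(c,1). -/
theorem logDiv_apply_eq_tsum {a : Bool → 𝔸 →L[ℂ] 𝔸} {x : ℝ} (ha : ∀ b, ‖a b‖ ≤ x)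
    (hx2 : Real.exp (2 * x) < 2) {v : 𝔸} (hv : a false v = 0) :
    logDiv (exp (a false) * exp (a true) - 1) v
      = v + ∑' c : List Bool, (f (c ++ [true]) : ℂ) • wordEval a c (a true v) := by
  have hx : 0 ≤ x := (norm_nonneg _).trans (ha true)
  have hs := (wSummable_f hx hx2).eval norm_one_clm_le ha
  have h1 : HasSum (fun c : List Bool => (f c : ℂ) • wordEval a c v) (ncEval a f v) :=
    hasSum_clm_apply hs.hasSum v
  rw [← ncEval_f norm_one_clm_le ha hx2, ← h1.tsum_eq, tsum_eq_nil_add_append_true h1.summable]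
  · congr 1
    · simp [f_nil, wordEval]
    · exact tsum_congr fun c => by rw [wordEval_append_apply]
  · intro c
    rw [wordEval_append_apply, hv, map_zero, smul_zero]

theorem g_mul_eq (c : List Bool) : ((c.length : ℝ) + 2) * g c
    = -f (c ++ [true]) - (-1 : ℝ) ^ c.length * f (c.map not ++ [true]) := by
  rw [g, mul_div_cancel₀]
  positivity

/-- The derivative of `t ↦ M(tA, tB)`. -/
theorem logDiv_add_logDiv_eq_tsum {A B : 𝔸} {t : ℂ} {x : ℝ} (hx0 : 0 < x)
    (hA : ‖t • adL 𝔸 A‖ ≤ x) (hB : ‖t • adL 𝔸 B‖ ≤ x) (hx2 : Real.exp (2 * x) < 2) :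
    logDiv (exp (adL 𝔸 (t • A)) * exp (adL 𝔸 (t • B)) - 1) A
        + logDiv (exp (adL 𝔸 (-(t • B))) * exp (adL 𝔸 (-(t • A))) - 1) B
      = A + B + ∑' c : List Bool, (((c.length : ℂ) + 2) * t ^ (c.length + 1)) •
          ((g c : ℂ) • wordEval (adGen A B) c (adL 𝔸 A B)) := by
  set a : Bool → 𝔸 →L[ℂ] 𝔸 := fun b => t • adGen A B b with ha_def
  -- The series applied to B has the letters exchanged and negated. Reindexing by `swapEquiv` yields
  -- the term (-1)ⁿ f(1-c,1).
  set a' : Bool → 𝔸 →L[ℂ] 𝔸 := fun b => (-t) • adGen A B (!b) with ha'_def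
  have ha : ∀ b, ‖a b‖ ≤ x := by
    rintro (_ | _)
    · simpa [a, adGen] using hA
    · simpa [a, adGen] using hB
  have ha' : ∀ b, ‖a' b‖ ≤ x := by
    rintro (_ | _)
    · exact norm_neg_smul_le (E := 𝔸 →L[ℂ] 𝔸) (t := t) (v := adL 𝔸 B) hB
    · exact norm_neg_smul_le (E := 𝔸 →L[ℂ] 𝔸) (t := t) (v := adL 𝔸 A) hA
  have e1 : adL 𝔸 (t • A) = a false := by simp [a, adGen]
  have e2 : adL 𝔸 (t • B) = a true := by simp [a, adGen]
  have e3 : adL 𝔸 (-(t • B)) = a' false := by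
    rw [← neg_smul, map_smul]
    rfl
  have e4 : adL 𝔸 (-(t • A)) = a' true := by
    rw [← neg_smul, map_smul]
    rfl
  have h1 := logDiv_apply_eq_tsum ha hx2 (v := A) (by simp [a, adGen])
  have h2 := logDiv_apply_eq_tsum ha' hx2 (v := B) (by simp [a', adGen])
  have hC : a true A = -(t • adL 𝔸 A B) := by simp [a, adGen, ← smul_neg]
  have hC' : a' true B = -(t • adL 𝔸 A B) := by simp [a', adGen]
  rw [e1, e2, e3, e4, h1, h2, hC, hC']
  set C := adL 𝔸 A B with hCdef
  have k1 : ∀ c : List Bool, (f (c ++ [true]) : ℂ) • wordEval a c (-(t • C))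
      = (-(f (c ++ [true])) : ℂ) • (t ^ (c.length + 1) • wordEval (adGen A B) c C) := by
    intro c
    rw [ha_def, wordEval_smul_apply, map_neg, map_smul, smul_neg, smul_neg, neg_smul, smul_smul
      (t ^ _) t, pow_succ]
  have k2 : ∀ c : List Bool, (f (c ++ [true]) : ℂ) • wordEval a' c (-(t • C))
      = (-((-1) ^ c.length * f (c ++ [true])) : ℂ) •
        (t ^ (c.length + 1) • wordEval (adGen A B) (c.map not) C) := by
    intro c
    rw [ha'_def, wordEval_smul_apply (fun b => adGen A B (!b)), wordEval_comp_not, map_neg,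
      map_smul, smul_neg, smul_neg, neg_smul, smul_smul, smul_smul, smul_smul, neg_pow t, pow_succ]
    congr 2
    ring
  have hterm : ∀ φ : List Bool → ℝ, Summable (fun c : List Bool => |φ c| * x ^ c.length) →
      Summable fun c : List Bool =>
        (φ c : ℂ) • (t ^ (c.length + 1) • wordEval (adGen A B) c C) := by
    intro φ hφ
    refine Summable.of_norm_bounded ((hφ.mul_right ‖C‖).mul_left ‖t‖) fun c => ?_
    have : (φ c : ℂ) • (t ^ (c.length + 1) • wordEval (adGen A B) c C)
        = t • ((φ c : ℂ) • wordEval a c C) := by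
      rw [ha_def, wordEval_smul_apply, smul_smul, smul_smul, smul_smul, pow_succ]
      congr 1
      ring
    rw [this, norm_smul]
    exact mul_le_mul_of_nonneg_left (norm_smul_wordEval_apply_le ha _ c C) (norm_nonneg _)
  have s1 := hterm (fun c => -f (c ++ [true])) (by simpa using summable_f_append hx0 hx2)
  have s2 := hterm (fun c => -((-1) ^ c.length * f (c.map not ++ [true])))
    (by simpa [abs_mul] using summable_f_swap hx0 hx2)
  have k3 : ∑' c : List Bool, (f (c ++ [true]) : ℂ) • wordEval a' c (-(t • C))
      = ∑' c : List Bool, ((-((-1) ^ c.length * f (c.map not ++ [true])) : ℝ) : ℂ) •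
        (t ^ (c.length + 1) • wordEval (adGen A B) c C) := by
    rw [← swapEquiv.tsum_eq]
    refine tsum_congr fun c => ?_
    rw [k2]
    simp [swapEquiv, Function.comp_def]
  have k4 : ∑' c : List Bool, (f (c ++ [true]) : ℂ) • wordEval a c (-(t • C))
      = ∑' c : List Bool, ((-f (c ++ [true]) : ℝ) : ℂ) •
        (t ^ (c.length + 1) • wordEval (adGen A B) c C) :=
    tsum_congr fun c => by rw [k1]; simp
  rw [k3, k4, add_add_add_comm, ← s1.tsum_add s2]
  congr 1
  refine tsum_congr fun c => ?_
  have h3 := congrArg (fun r : ℝ => (r : ℂ)) (g_mul_eq c)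
  push_cast at h3
  rw [← add_smul, smul_smul, smul_smul]
  congr 1
  push_cast
  linear_combination (-t ^ (c.length + 1)) * h3

/-- The Baker-Campbell-Hausdorff theorem for the series with coefficients `g`. -/
theorem exp_bch_eq {A B : 𝔸} {x y : ℝ} (hy : 0 < y) (hyx : y < x) (hA : ‖adL 𝔸 A‖ ≤ y)
    (hB : ‖adL 𝔸 B‖ ≤ y) (hx2 : Real.exp (2 * x) < 2) :
    exp (A + B + ∑' c : List Bool, (g c : ℂ) • wordEval (adGen A B) c (adL 𝔸 A B))
      = exp A * exp B := by
  have hx0 : 0 < x := hy.trans hyx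
  set C := adL 𝔸 A B with hCdef
  -- The slack y < x gives R > 1, so t = 1 is interior to the disc, while t·ad A and t·ad B keep
  -- norm at most x on it.
  set R : ℝ := x / y with hR
  have hR1 : 1 < R := (one_lt_div hy).2 hyx
  have hR0 : 0 < R := one_pos.trans hR1
  have hgen : ∀ b, ‖adGen A B b‖ ≤ y := by
    rintro (_ | _)
    · simpa [adGen] using hA
    · simpa [adGen] using hB
  set T : List Bool → 𝔸 := fun c => (g c : ℂ) • wordEval (adGen A B) c C with hT
  set M : ℂ → 𝔸 := fun t => t • A + t • B + ∑' c : List Bool, t ^ (c.length + 2) • T c with hM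
  set U : Set ℂ := Metric.ball 0 R with hU
  have hUo : IsOpen U := Metric.isOpen_ball
  have hUc : IsPreconnected U := (convex_ball _ _).isPreconnected
  have h0U : (0 : ℂ) ∈ U := by simp [hU, hR0]
  have h1U : (1 : ℂ) ∈ U := by rw [hU, mem_ball_zero_iff]; simpa using hR1
  have hbound : ∀ (c : List Bool), ∀ t ∈ U,
      ‖(((c.length : ℂ) + 2) * t ^ (c.length + 1)) • T c‖
        ≤ (R * ‖C‖) * ((|f (c ++ [true])| + |f (c.map not ++ [true])|) * x ^ c.length) := by
    intro c t ht
    rw [hU, mem_ball_zero_iff] at ht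
    have h1 : ‖(c.length : ℂ) + 2‖ = (c.length : ℝ) + 2 := by
      rw [show (c.length : ℂ) + 2 = ((c.length + 2 : ℕ) : ℂ) by push_cast; rfl,
        Complex.norm_natCast]
      push_cast
      rfl
    -- The factor n + 2 from differentiating t^{n+2} cancels the denominator of g, so summability of
    -- f controls the derivative.
    have h2 : ((c.length : ℝ) + 2) * |g c| ≤ |f (c ++ [true])| + |f (c.map not ++ [true])| := by
      rw [← abs_of_pos (by positivity : (0 : ℝ) < (c.length : ℝ) + 2), ← abs_mul, g_mul_eq]
      refine (abs_sub _ _).trans_eq ?_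
      simp [abs_mul]
    have h3 : x ^ c.length = R ^ c.length * y ^ c.length := by
      rw [← mul_pow, hR, div_mul_cancel₀ _ hy.ne']
    rw [norm_smul, norm_mul, h1, norm_pow, h3]
    calc ((c.length : ℝ) + 2) * ‖t‖ ^ (c.length + 1) * ‖T c‖
        ≤ ((c.length : ℝ) + 2) * R ^ (c.length + 1) * (|g c| * y ^ c.length * ‖C‖) := by
          gcongr
          exact norm_smul_wordEval_apply_le hgen _ _ _
      _ = (((c.length : ℝ) + 2) * |g c|) * (R * ‖C‖ * (R ^ c.length * y ^ c.length)) := by ring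
      _ ≤ (|f (c ++ [true])| + |f (c.map not ++ [true])|)
            * (R * ‖C‖ * (R ^ c.length * y ^ c.length)) := by
          gcongr
      _ = _ := by ring
  have hMd : ∀ t ∈ U, HasDerivAt M (A + B + ∑' c : List Bool,
      (((c.length : ℂ) + 2) * t ^ (c.length + 1)) • T c) t := by
    intro t ht
    have hlin : ∀ X : 𝔸, HasDerivAt (fun t : ℂ => t • X) X t := fun X => by
      simpa using (hasDerivAt_id t).smul_const X
    have hsum : Summable fun c : List Bool => (R * ‖C‖) *
        ((|f (c ++ [true])| + |f (c.map not ++ [true])|) * x ^ c.length) := by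
      refine (((summable_f_append hx0 hx2).add (summable_f_swap hx0 hx2)).congr
        fun c => ?_).mul_left _
      rw [add_mul]
    refine ((hlin A).add (hlin B)).add (hasDerivAt_tsum_of_isPreconnected hsum hUo hUc
      (fun c s _ => ?_) hbound h0U ?_ ht)
    · have := (hasDerivAt_pow (c.length + 2) s).smul_const (T c)
      refine this.congr_deriv ?_
      push_cast
      rfl
    · simp
  obtain ⟨L, hL0, hL⟩ := exists_local_log A B
  obtain ⟨r, hr, hball⟩ := Metric.eventually_nhds_iff_ball.1 (hL.and (hUo.mem_nhds h0U))
  have hLM : Set.EqOn L M (Metric.ball 0 r) := by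
    refine Metric.isOpen_ball.eqOn_of_deriv_eq (𝕜 := ℂ) (convex_ball _ _).isPreconnected
      (fun t ht => (hball t ht).1.2.differentiableAt.differentiableWithinAt)
      (fun t ht => (hMd t (hball t ht).2).differentiableAt.differentiableWithinAt)
      (fun t ht => ?_) (Metric.mem_ball_self hr) (by simp [hL0, hM])
    have ht' : ‖t‖ < R := by simpa [hU] using (hball t ht).2
    have hle : ∀ φ : 𝔸 →L[ℂ] 𝔸, ‖φ‖ ≤ y → ‖t • φ‖ ≤ x := by
      intro φ hφ
      rw [norm_smul, ← div_mul_cancel₀ x hy.ne']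
      exact mul_le_mul ht'.le hφ (norm_nonneg _) hR0.le
    rw [(hball t ht).1.2.deriv, (hMd t (hball t ht).2).deriv,
      logDiv_add_logDiv_eq_tsum hx0 (hle _ hA) (hle _ hB) hx2]
  have hev : (fun t => exp (M t)) =ᶠ[𝓝 0] fun t : ℂ => exp (t • A) * exp (t • B) := by
    filter_upwards [Metric.ball_mem_nhds (0 : ℂ) hr] with t ht
    rw [← hLM ht, (hball t ht).1.1]
  -- L exists only near 0, so the exponentials are continued instead: both sides are holomorphic on
  -- the disc and agree near 0.
  have ha1 : AnalyticOnNhd ℂ (fun t => exp (M t)) U := by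
    refine DifferentiableOn.analyticOnNhd (fun t ht => ?_) hUo
    exact ((differentiable_exp (M t)).comp t
      (hMd t ht).differentiableAt).differentiableWithinAt
  have ha2 : AnalyticOnNhd ℂ (fun t : ℂ => exp (t • A) * exp (t • B)) U := by
    refine DifferentiableOn.analyticOnNhd (fun t ht => ?_) hUo
    exact ((hasDerivAt_exp_smul_const A t).mul
      (hasDerivAt_exp_smul_const B t)).differentiableAt.differentiableWithinAt
  have := ha1.eqOn_of_preconnected_of_eventuallyEq ha2 hUc h0U hev h1U
  simpa [hM, hT] using this

end Series

end BCH

namespace BCH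

/-! ### The quadratic form of the series under skew letters -/

section Quadratic

theorem tsum_eq_nil_add_cons {E : Type*} [NormedAddCommGroup E] [CompleteSpace E]
    {φ : List Bool → E} (hφ : Summable φ) :
    ∑' c, φ c = φ [] + (∑' c, φ (true :: c) + ∑' c, φ (false :: c)) := by
  have hinj : ∀ b : Bool, Function.Injective fun c : List Bool => b :: c :=
    fun b => List.cons_injective
  have hpart : ∀ b : Bool, HasSum (fun c => if c.head? = some b then φ c else 0)
      (∑' c, φ (b :: c)) := by
    intro b
    rw [← (hinj b).hasSum_iff]
    · refine hasSum_congr_fun (hφ.comp_injective (hinj b)).hasSum fun c => by simp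
    · intro c hc
      rw [if_neg]
      intro h
      cases c with
      | nil => simp at h
      | cons d c => exact hc ⟨c, by simpa using h.symm⟩
  refine HasSum.tsum_eq (hasSum_congr_fun
    ((hasSum_ite_eq [] (φ [])).add ((hpart true).add (hpart false))) fun c => ?_)
  cases c with
  | nil => simp
  | cons d c => cases d <;> simp

variable {E : Type*}

/-- The action of a word on a vector, given the actions of the letters. -/
def wordAct (a : Bool → E → E) (c : List Bool) (v : E) : E := c.foldr a v

theorem wordAct_append (a : Bool → E → E) (c d : List Bool) (v : E) :
    wordAct a (c ++ d) v = wordAct a c (wordAct a d v) := by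
  simp [wordAct]

variable [NormedAddCommGroup E] {a : Bool → E → E} {y : ℝ}

theorem norm_wordAct_le (hy : 0 ≤ y) (ha : ∀ b v, ‖a b v‖ ≤ y * ‖v‖) (c : List Bool) (v : E) :
    ‖wordAct a c v‖ ≤ y ^ c.length * ‖v‖ := by
  induction c with
  | nil => simp [wordAct]
  | cons b c ih =>
    rw [List.length_cons, pow_succ', mul_assoc]
    exact (ha b _).trans (mul_le_mul_of_nonneg_left ih hy)

theorem summable_g_wordAct [NormedSpace ℝ E] [CompleteSpace E] (hy : 0 ≤ y)
    (ha : ∀ b v, ‖a b v‖ ≤ y * ‖v‖) (hg : WSummable y g) (v : E) : Summable fun c : List Bool => g c • wordAct a c v := by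
  refine Summable.of_norm_bounded (hg.mul_right ‖v‖) fun c => ?_
  rw [norm_smul, Real.norm_eq_abs, mul_assoc]
  exact mul_le_mul_of_nonneg_left (norm_wordAct_le hy ha c v) (abs_nonneg _)

variable [InnerProductSpace ℝ E]

local notation "⟪" u ", " v "⟫" => inner ℝ u v

/-- Each skew letter that crosses the inner product changes the sign, and the letters arrive in
opposite order. This explains the sign and the reversal in `h`. -/
theorem inner_wordAct (hskew : ∀ b u v, ⟪a b u, v⟫ = -⟪u, a b v⟫) (c : List Bool) (u v : E) :
    ⟪wordAct a c u, v⟫ = (-1) ^ c.length * ⟪u, wordAct a c.reverse v⟫ := by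
  induction c generalizing v with
  | nil => simp [wordAct]
  | cons b c ih =>
    have h1 : wordAct a (b :: c) u = a b (wordAct a c u) := rfl
    have h2 : wordAct a [b] v = a b v := rfl
    rw [h1, hskew, ih, List.reverse_cons, wordAct_append, h2, List.length_cons, pow_succ]
    ring

theorem abs_inner_wordAct_le (hy : 0 ≤ y) (ha : ∀ b v, ‖a b v‖ ≤ y * ‖v‖) (c : List Bool) (v : E) :
    |⟪v, wordAct a c v⟫| ≤ y ^ c.length * ‖v‖ ^ 2 := by
  refine (abs_real_inner_le_norm _ _).trans ?_
  calc ‖v‖ * ‖wordAct a c v‖ ≤ ‖v‖ * (y ^ c.length * ‖v‖) :=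
        mul_le_mul_of_nonneg_left (norm_wordAct_le hy ha c v) (norm_nonneg _)
    _ = _ := by ring

variable [CompleteSpace E]

/-- Expand ⟪S,S⟫ over pairs of words, move the left word across, and collect the pairs by their
concatenation. -/
theorem norm_sq_tsum_wordAct (hy : 0 ≤ y) (ha : ∀ b v, ‖a b v‖ ≤ y * ‖v‖) (hg : WSummable y g)
    (hskew : ∀ b u v, ⟪a b u, v⟫ = -⟪u, a b v⟫) (v : E) :
    HasSum (fun w : List Bool => (∑ m ∈ Finset.range (w.length + 1),
      (-1 : ℝ) ^ m * g (w.take m).reverse * g (w.drop m)) * ⟪v, wordAct a w v⟫)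
      (‖∑' c : List Bool, g c • wordAct a c v‖ ^ 2) := by
  set φ : List Bool → List Bool → ℝ := fun c d =>
    (-1 : ℝ) ^ c.length * g c.reverse * g d * ⟪v, wordAct a (c ++ d) v⟫ with hφ
  have hφs : Summable fun p : List Bool × List Bool => φ p.1 p.2 := by
    refine Summable.of_norm_bounded ((summable_prod_weight hy hg.comp_reverse hg).mul_right
      (‖v‖ ^ 2)) fun p => ?_
    rw [Real.norm_eq_abs, abs_mul, abs_mul, abs_mul, abs_pow, abs_neg, abs_one, one_pow, one_mul]
    calc |g p.1.reverse| * |g p.2| * |⟪v, wordAct a (p.1 ++ p.2) v⟫|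
        ≤ |g p.1.reverse| * |g p.2| * (y ^ (p.1 ++ p.2).length * ‖v‖ ^ 2) :=
          mul_le_mul_of_nonneg_left (abs_inner_wordAct_le hy ha _ v) (by positivity)
      _ = _ := by
          rw [List.length_append, pow_add]
          ring
  have hsum := summable_g_wordAct hy ha hg v
  set S := ∑' c : List Bool, g c • wordAct a c v with hS
  have hfib : ∀ c : List Bool, HasSum (fun d => φ c d)
      (g c.reverse * ⟪wordAct a c.reverse v, S⟫) := by
    intro c
    have h1 : HasSum (fun d => ⟪wordAct a c.reverse v, g d • wordAct a d v⟫)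
        ⟪wordAct a c.reverse v, S⟫ := (innerSL ℝ (wordAct a c.reverse v)).hasSum hsum.hasSum
    refine hasSum_congr_fun (h1.mul_left (g c.reverse)) fun d => ?_
    rw [inner_smul_right, inner_wordAct hskew, List.reverse_reverse, List.length_reverse]
    simp only [hφ, wordAct_append]
    ring
  have hrev : HasSum (fun c : List Bool => g c.reverse * ⟪wordAct a c.reverse v, S⟫) (‖S‖ ^ 2) := by
    have h1 : HasSum (fun c => ⟪S, g c • wordAct a c v⟫) ⟪S, S⟫ :=
      (innerSL ℝ S).hasSum hsum.hasSum
    rw [real_inner_self_eq_norm_sq, ← reverseEquiv.hasSum_iff] at h1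
    refine hasSum_congr_fun h1 fun c => ?_
    simp only [Function.comp_apply, inner_smul_right]
    rw [real_inner_comm]
    rfl
  have htot : ∑' p : List Bool × List Bool, φ p.1 p.2 = ‖S‖ ^ 2 := by
    rw [hφs.tsum_prod, ← hrev.tsum_eq]
    exact tsum_congr fun c => (hfib c).tsum_eq
  have hcut := (summable_sum_cut hφs).hasSum
  rw [tsum_sum_cut hφs, htot] at hcut
  refine hasSum_congr_fun hcut fun w => ?_
  rw [Finset.sum_mul]
  refine Finset.sum_congr rfl fun i hi => ?_
  have hi' : (w.take i).length = i := by
    rw [List.length_take, Finset.mem_range] at *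
    omega
  simp only [hφ, List.take_append_drop, hi']

/-- The expansion of `‖M‖² - ‖P + Q‖²` with the coefficients `h`. -/
theorem norm_sq_bch_eq (hy : 0 < y) (ha : ∀ b v, ‖a b v‖ ≤ y * ‖v‖) (hg : WSummable y g)
    (hskew : ∀ b u v, ⟪a b u, v⟫ = -⟪u, a b v⟫) {P C : E}
    (ht : ∀ u, ⟪P, a true u⟫ = ⟪C, u⟫) (hf : ∀ u, ⟪P, a false u⟫ = -⟪C, u⟫) (hPC : ⟪P, C⟫ = 0) :
    HasSum (fun c : List Bool => h c * ⟪C, wordAct a c C⟫)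
      (‖P + ∑' c : List Bool, g c • wordAct a c C‖ ^ 2 - ‖P‖ ^ 2) := by
  have hsum := summable_g_wordAct hy.le ha hg C
  have hsq := norm_sq_tsum_wordAct hy.le ha hg hskew C
  set S := ∑' c : List Bool, g c • wordAct a c C with hS
  have hlin : HasSum (fun c => ⟪P, g c • wordAct a c C⟫) ⟪P, S⟫ :=
    (innerSL ℝ P).hasSum hsum.hasSum
  have hcons : ∀ b : Bool, Summable fun c => g (b :: c) * ⟪C, wordAct a c C⟫ := by
    intro b
    refine Summable.of_norm_bounded ((hg.comp_cons hy b).mul_right (‖C‖ ^ 2)) fun c => ?_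
    rw [norm_mul, Real.norm_eq_abs, Real.norm_eq_abs, mul_assoc]
    exact mul_le_mul_of_nonneg_left (abs_inner_wordAct_le hy.le ha c C) (abs_nonneg _)
  -- The first letter is absorbed by P, turning it into ±C; the empty word drops out because P ⊥ C.
  have hPS : ⟪P, S⟫ = ∑' c, g (true :: c) * ⟪C, wordAct a c C⟫
      - ∑' c, g (false :: c) * ⟪C, wordAct a c C⟫ := by
    rw [← hlin.tsum_eq, tsum_eq_nil_add_cons hlin.summable, sub_eq_add_neg, ← tsum_neg]
    have h0 : wordAct a [] C = C := rfl
    rw [h0, inner_smul_right, hPC, mul_zero, zero_add]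
    congr 1
    · refine tsum_congr fun c => ?_
      rw [inner_smul_right]
      exact congrArg _ (ht _)
    · refine tsum_congr fun c => ?_
      rw [inner_smul_right, ← mul_neg]
      exact congrArg _ (hf _)
  have htot := (((hcons true).hasSum.mul_left 2).sub ((hcons false).hasSum.mul_left 2)).add hsq
  have hval : 2 * ∑' c, g (true :: c) * ⟪C, wordAct a c C⟫
      - 2 * ∑' c, g (false :: c) * ⟪C, wordAct a c C⟫ + ‖S‖ ^ 2 = ‖P + S‖ ^ 2 - ‖P‖ ^ 2 := by
    rw [norm_add_sq_real, hPS]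
    ring
  rw [hval] at htot
  refine hasSum_congr_fun htot fun c => ?_
  rw [h]
  ring

theorem norm_bch_le {δ : ℝ} (hy : 0 < y) (ha : ∀ b v, ‖a b v‖ ≤ y * ‖v‖)
    (hskew : ∀ b u v, ⟪a b u, v⟫ = -⟪u, a b v⟫) {P C : E}
    (ht : ∀ u, ⟪P, a true u⟫ = ⟪C, u⟫) (hf : ∀ u, ⟪P, a false u⟫ = -⟪C, u⟫) (hPC : ⟪P, C⟫ = 0)
    (hδ0 : 0 ≤ δ) (hδ1 : δ ≤ 1) (hyδ : y ≤ Real.log 2 / 3 * δ)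
    (hδ : δ * ∑' n : ℕ, hTerm (n + 1) ≤ 1 / 12) :
    ‖P + ∑' c : List Bool, g c • wordAct a c C‖ ^ 2 ≤ ‖P‖ ^ 2 := by
  have hx := log_two_div_three_pos
  have hyx : y ≤ Real.log 2 / 3 := hyδ.trans (mul_le_of_le_one_right hx.le hδ1)
  have hg : WSummable y g := wSummable_g hy
    ((Real.exp_le_exp.2 (by linarith)).trans_lt exp_two_mul_log_two_div_three_lt)
  have hmain := norm_sq_bch_eq hy ha hg hskew ht hf hPC
  have hs := summable_ofFn hmain.summable
  have hT := tsum_ofFn hmain.summable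
  rw [hmain.tsum_eq, hs.tsum_eq_zero_add] at hT
  have h0 : ∑ c : Fin 0 → Bool, h (List.ofFn c) * ⟪C, wordAct a (List.ofFn c) C⟫
      = -(1 / 12) * ‖C‖ ^ 2 := by
    have h00 : wordAct a [] C = C := rfl
    simp [h_nil, h00]
  have hle : ‖∑' n : ℕ, ∑ c : Fin (n + 1) → Bool, h (List.ofFn c) *
      ⟪C, wordAct a (List.ofFn c) C⟫‖ ≤ ‖C‖ ^ 2 * δ * ∑' n : ℕ, hTerm (n + 1) := by
    refine tsum_of_norm_bounded
      (((summable_nat_add_iff 1).2 summable_hTerm).hasSum.mul_left (‖C‖ ^ 2 * δ)) fun n => ?_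
    rw [hTerm, Finset.mul_sum]
    refine norm_sum_le_of_le _ fun c _ => ?_
    rw [norm_mul, Real.norm_eq_abs, Real.norm_eq_abs]
    have h1 := abs_inner_wordAct_le hy.le ha (List.ofFn c) C
    rw [List.length_ofFn] at h1
    -- Since δ ≤ 1 and the word is nonempty, one factor δ can be kept and the others dropped.
    have h2 : y ^ (n + 1) ≤ (Real.log 2 / 3) ^ (n + 1) * δ := by
      calc y ^ (n + 1) ≤ (Real.log 2 / 3 * δ) ^ (n + 1) := pow_le_pow_left₀ hy.le hyδ _
        _ = (Real.log 2 / 3) ^ (n + 1) * δ ^ (n + 1) := mul_pow _ _ _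
        _ ≤ _ := by
            gcongr
            exact pow_le_of_le_one hδ0 hδ1 n.succ_ne_zero
    calc |h (List.ofFn c)| * |⟪C, wordAct a (List.ofFn c) C⟫|
        ≤ |h (List.ofFn c)| * ((Real.log 2 / 3) ^ (n + 1) * δ * ‖C‖ ^ 2) := by
          gcongr
          exact h1.trans (mul_le_mul_of_nonneg_right h2 (by positivity))
      _ = _ := by ring
  have hle' := (le_abs_self _).trans hle
  rw [h0] at hT
  nlinarith [mul_le_mul_of_nonneg_left hδ (sq_nonneg ‖C‖)]

end Quadratic

end BCH

namespace BCH

/-! ### Matrices with the Frobenius norm -/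

section Frobenius

open scoped Matrix.Norms.Frobenius

variable {ι : Type*} [Fintype ι] [DecidableEq ι]

theorem frobenius_norm_sq (A : Matrix ι ι ℂ) : ‖A‖ ^ 2 = (Matrix.trace (Aᴴ * A)).re := by
  rw [Matrix.frobenius_norm_def, ← Real.sqrt_eq_rpow, Real.sq_sqrt (by positivity), Finset.sum_comm]
  simp only [Matrix.trace, Matrix.diag_apply, Matrix.mul_apply, Matrix.conjTranspose_apply,
    Complex.re_sum]
  refine Finset.sum_congr rfl fun i _ => Finset.sum_congr rfl fun j _ => ?_
  rw [Real.rpow_two, ← Complex.normSq_eq_norm_sq, Complex.normSq_apply]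
  simp

theorem frobNorm_eq_norm (A : Matrix ι ι ℂ) : frobNorm A = ‖A‖ := by
  rw [frobNorm, ← frobenius_norm_sq, Real.sqrt_sq (norm_nonneg A)]

/-- The real inner product `Re tr X† Y` of the Frobenius norm. -/
@[reducible] noncomputable def frobeniusInner : InnerProductSpace ℝ (Matrix ι ι ℂ) where
  inner X Y := (Matrix.trace (Xᴴ * Y)).re
  norm_sq_eq_re_inner X := frobenius_norm_sq X
  conj_inner_symm X Y := by
    have : Xᴴ * Y = (Yᴴ * X)ᴴ := by simp
    simp only [conj_trivial]
    rw [this, Matrix.trace_conjTranspose]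
    simp
  add_left X Y Z := by simp [add_mul]
  smul_left X Y r := by simp [Matrix.conjTranspose_smul]

-- Skewness of ad A combines A† = -A with the cyclicity of the trace.
omit [DecidableEq ι] in
theorem re_trace_skew {A : Matrix ι ι ℂ} (hA : Aᴴ = -A) (U V : Matrix ι ι ℂ) :
    (Matrix.trace ((A * U - U * A)ᴴ * V)).re = -(Matrix.trace (Uᴴ * (A * V - V * A))).re := by
  have h1 : (A * U - U * A)ᴴ * V = -(Uᴴ * (A * V)) + A * (Uᴴ * V) := by
    rw [Matrix.conjTranspose_sub, Matrix.conjTranspose_mul, Matrix.conjTranspose_mul, hA]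
    noncomm_ring
  have h2 : Matrix.trace (A * (Uᴴ * V)) = Matrix.trace (Uᴴ * (V * A)) := by
    rw [Matrix.trace_mul_comm, Matrix.mul_assoc]
  rw [h1, Matrix.trace_add, Matrix.trace_neg, h2, Matrix.mul_sub, Matrix.trace_sub,
    ← Complex.neg_re]
  congr 1
  ring

/-- The actions of the two letters on matrices. -/
def adLetter (A B : Matrix ι ι ℂ) (b : Bool) (X : Matrix ι ι ℂ) : Matrix ι ι ℂ :=
  if b then B * X - X * B else A * X - X * A

omit [DecidableEq ι] in
theorem adWord_eq_wordAct (A B : Matrix ι ι ℂ) (c : List Bool) (X : Matrix ι ι ℂ) :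
    adWord A B c X = wordAct (adLetter A B) c X := by
  induction c with
  | nil => rfl
  | cons b c ih => cases b <;> simp [adWord, wordAct, adLetter, ih]

theorem wordEval_adGen_apply (A B : Matrix ι ι ℂ) (c : List Bool) (X : Matrix ι ι ℂ) :
    wordEval (adGen A B) c X = wordAct (adLetter A B) c X := by
  induction c with
  | nil => rfl
  | cons b c ih => rw [wordEval_cons_apply, ih]; cases b <;> rfl

theorem norm_adL_le (A : Matrix ι ι ℂ) : ‖adL (Matrix ι ι ℂ) A‖ ≤ 2 * ‖A‖ := by
  refine ContinuousLinearMap.opNorm_le_bound _ (by positivity) fun X => ?_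
  rw [adL_apply]
  have h1 := norm_mul_le A X
  have h2 := norm_mul_le X A
  refine (norm_sub_le _ _).trans ?_
  linarith

theorem norm_adLetter_le {A B : Matrix ι ι ℂ} {y : ℝ} (hA : 2 * ‖A‖ ≤ y) (hB : 2 * ‖B‖ ≤ y)
    (b : Bool) (X : Matrix ι ι ℂ) : ‖adLetter A B b X‖ ≤ y * ‖X‖ := by
  cases b
  · exact ((adL _ A).le_opNorm X).trans
      (mul_le_mul_of_nonneg_right ((norm_adL_le A).trans hA) (norm_nonneg X))
  · exact ((adL _ B).le_opNorm X).trans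
      (mul_le_mul_of_nonneg_right ((norm_adL_le B).trans hB) (norm_nonneg X))

/-- As ‖ad A‖ ≤ 2‖A‖, this converts the bound Δ on the matrices into the bound on the letters
required by `norm_bch_le`. -/
theorem two_mul_bigDelta_le : 2 * bigDelta ≤ Real.log 2 / 3 * smallDelta := by
  have := min_le_left (Real.log 2 / 6 * smallDelta) (1 / 4 * Real.log 2)
  rw [bigDelta]
  linarith

theorem smallDelta_mul_le : smallDelta * ∑' n : ℕ, hTerm (n + 1) ≤ 1 / 12 := by
  have hT := tsum_hTerm_pos
  calc _ ≤ (1 / 12 * (∑' n : ℕ, hTerm (n + 1))⁻¹) * ∑' n : ℕ, hTerm (n + 1) :=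
        mul_le_mul_of_nonneg_right (min_le_left _ _) hT.le
    _ = _ := by rw [mul_assoc, inv_mul_cancel₀ hT.ne', mul_one]

variable {A B : Matrix ι ι ℂ}

theorem summable_adWord (hA : ‖A‖ < bigDelta) (hB : ‖B‖ < bigDelta) :
    Summable fun c : List Bool => g c • wordAct (adLetter A B) c (A * B - B * A) := by
  have hx := log_two_div_three_pos
  have h1 : smallDelta ≤ 1 := min_le_right _ _
  have h2 := two_mul_bigDelta_le.trans (mul_le_of_le_one_right hx.le h1)
  exact summable_g_wordAct hx.le
    (norm_adLetter_le (y := Real.log 2 / 3) (by linarith) (by linarith))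
    (wSummable_g hx exp_two_mul_log_two_div_three_lt) _

omit [DecidableEq ι] in
theorem bchTerm_eq (A B : Matrix ι ι ℂ) : bchTerm A B = fun n : ℕ => ∑ c : Fin n → Bool,
    g (List.ofFn c) • wordAct (adLetter A B) (List.ofFn c) (A * B - B * A) := by
  funext n
  simp only [bchTerm, adWord_eq_wordAct]

theorem summable_bchTerm (hA : ‖A‖ < bigDelta) (hB : ‖B‖ < bigDelta) :
    Summable (bchTerm A B) := by
  rw [bchTerm_eq]
  exact summable_ofFn
    (φ := fun c => g c • wordAct (adLetter A B) c (A * B - B * A))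
    (summable_adWord hA hB)

theorem bch_eq (hA : ‖A‖ < bigDelta) (hB : ‖B‖ < bigDelta) : bch A B
    = A + B + ∑' c : List Bool, g c • wordAct (adLetter A B) c (A * B - B * A) := by
  rw [bch, bchTerm_eq]
  exact congrArg (A + B + ·) (tsum_ofFn
    (φ := fun c => g c • wordAct (adLetter A B) c (A * B - B * A))
    (summable_adWord hA hB))

theorem exp_bch (hA : ‖A‖ < bigDelta) (hB : ‖B‖ < bigDelta) :
    NormedSpace.exp (bch A B) = NormedSpace.exp A * NormedSpace.exp B := by
  have hx := log_two_div_three_pos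
  have hlog := Real.log_pos one_lt_two
  have h1 : smallDelta ≤ 1 := min_le_right _ _
  have h2 := two_mul_bigDelta_le.trans (mul_le_of_le_one_right hx.le h1)
  -- Any radius strictly between log 2 / 3 and log 2 / 2 would do; `exp_bch_eq` needs strict room on
  -- both sides.
  have h3 : Real.exp (2 * (2 * Real.log 2 / 5)) < 2 := by
    calc _ < Real.exp (Real.log 2) := Real.exp_lt_exp.2 (by linarith)
      _ = 2 := Real.exp_log two_pos
  have hmain := exp_bch_eq (A := A) (B := B) hx
    (by linarith : Real.log 2 / 3 < 2 * Real.log 2 / 5)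
    ((norm_adL_le A).trans (by linarith)) ((norm_adL_le B).trans (by linarith)) h3
  refine Eq.trans (congrArg NormedSpace.exp ((bch_eq hA hB).trans ?_)) hmain
  refine congrArg (A + B + ·) (tsum_congr fun c => ?_)
  rw [wordEval_adGen_apply, adL_apply]
  exact (Complex.coe_smul _ _).symm

theorem norm_bch_sq_le (hA' : Aᴴ = -A) (hB' : Bᴴ = -B) (hA : ‖A‖ < bigDelta)
    (hB : ‖B‖ < bigDelta) : ‖bch A B‖ ^ 2 ≤ 2 * ‖A‖ ^ 2 + 2 * ‖B‖ ^ 2 - ‖A - B‖ ^ 2 := by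
  let _ := frobeniusInner (ι := ι)
  have hx := log_two_div_three_pos
  have hpos := bigDelta_pos
  have hskew : ∀ b U V, inner ℝ (adLetter A B b U) V = -inner ℝ U (adLetter A B b V) := by
    rintro (_ | _) U V
    · exact re_trace_skew hA' U V
    · exact re_trace_skew hB' U V
  have hskew' : ∀ b U V, inner ℝ U (adLetter A B b V) = -inner ℝ (adLetter A B b U) V :=
    fun b U V => by rw [hskew, neg_neg]
  have e1 : adLetter A B true (A + B) = -(A * B - B * A) := by
    simp only [adLetter, if_true]
    noncomm_ring
  have e2 : adLetter A B false (A + B) = A * B - B * A := by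
    simp only [adLetter, Bool.false_eq_true, if_false]
    noncomm_ring
  -- C is both ad(A)B and -ad(B)A; moving the letter across leaves [A,A] or [B,B].
  have hPC : inner ℝ (A + B) (A * B - B * A) = 0 := by
    have h1 : A * B - B * A = adLetter A B false B := rfl
    have h2 : A * B - B * A = -adLetter A B true A := by simp [adLetter]
    have h3 : ∀ b X, adLetter A B b X = if b then B * X - X * B else A * X - X * A := fun _ _ => rfl
    have h4 : inner ℝ A (A * B - B * A) = 0 := by
      rw [h1, hskew', h3]
      simp
    have h5 : inner ℝ B (A * B - B * A) = 0 := by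
      rw [h2, inner_neg_right, hskew', h3]
      simp
    rw [inner_add_left, h4, h5, add_zero]
  have hle := norm_bch_le (a := adLetter A B) (y := 2 * bigDelta) (P := A + B) (C := A * B - B * A)
    (by positivity) (norm_adLetter_le (by linarith) (by linarith)) hskew
    (fun U => by rw [hskew', e1, inner_neg_left, neg_neg]) (fun U => by rw [hskew', e2]) hPC
    smallDelta_pos.le (min_le_right _ _) two_mul_bigDelta_le smallDelta_mul_le
  rw [bch_eq hA hB]
  refine hle.trans_eq ?_
  have := parallelogram_law_with_norm ℝ A B
  linarith

end Frobenius

end BCH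

theorem mainTheorem3 :
    Summable (fun n : ℕ => BCH.hTerm (n + 1)) ∧ 0 < BCH.bigDelta ∧
      ∀ {ι : Type*} [Fintype ι] [DecidableEq ι] (A B : Matrix ι ι ℂ),
        Aᴴ = -A → Bᴴ = -B →
        BCH.frobNorm A < BCH.bigDelta → BCH.frobNorm B < BCH.bigDelta →
          Summable (BCH.bchTerm A B) ∧
          NormedSpace.exp (BCH.bch A B) = NormedSpace.exp A * NormedSpace.exp B ∧
          BCH.frobNorm (BCH.bch A B) ^ 2 ≤
            2 * BCH.frobNorm A ^ 2 + 2 * BCH.frobNorm B ^ 2 - BCH.frobNorm (A - B) ^ 2 := by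
  refine ⟨(summable_nat_add_iff 1).2 BCH.summable_hTerm, BCH.bigDelta_pos, ?_⟩
  intro ι _ _ A B hA' hB' hA hB
  simp only [BCH.frobNorm_eq_norm] at hA hB ⊢
  exact ⟨BCH.summable_bchTerm hA hB, BCH.exp_bch hA hB, BCH.norm_bch_sq_le hA' hB' hA hB⟩
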